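/- Let $G$ be a compact connected metric graph: it has a finite set of $n_V$ vertices and finitely many edges, each edge $e$ being an interval $[0,\ell_e]$ with $0<\ell_e<\infty$ whose two ends are attached to vertices (loops and multiple edges are allowed). Let $L=-d^2/dx^2$ be the operator on $L^2(G)$ with standard Kirchhoff–Neumann conditions, i.e. its domain consists of the continuous functions on $G$ that are $H^2$ on each edge and whose outgoing derivatives sum to zero at each vertex. Let $\operatorname{dist}(x,y)$ be the length of the shortest path in $G$ between two points, $\operatorname{diam}(G)=\sup\{\operatorname{dist}(x,y): x,y\in G\}$, and let $\operatorname{diam}_V(G)$ be the maximal distance between two vertices of $G$. If $n_V\ge 2$, then $L$ has a lowest nonzero eigenvalue $\lambda_1$ (the spectral gap), and it satisfies both $$\lambda_1\le\left(\frac{\pi(n_V+2)}{2\operatorname{diam}(G)}\right)^2\qquad\text{and}\qquad \lambda_1\le\left(\frac{\pi n_V}{2\operatorname{diam}_V(G)}\right)^2 .$$ -/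

import Mathlib

open MeasureTheory

/-- A metric graph with vertex set `V` and edge set `E`: the edge `e` is a copy of the interval
`[0, len e]`, whose end `0` is attached to the vertex `src e` and whose end `len e` is attached to
the vertex `tgt e`. Loops and multiple edges are allowed, and the choice of orientation plays no
role. When `V` and `E` are finite, the metric graph is compact. -/
structure MetricGraph (V E : Type*) where
  src : E → V
  tgt : E → V
  len : E → ℝ
  len_pos : ∀ e, 0 < len e

namespace MetricGraph

variable {V E : Type*} (G : MetricGraph V E)

/-- The disjoint union of the vertices and of the closed edges, before gluing. -/
abbrev PrePoint : Type _ := V ⊕ (Σ e : E, Set.Icc (0 : ℝ) (G.len e))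

/-- The gluing of the ends of the edges to the vertices. -/
inductive Glue : G.PrePoint → G.PrePoint → Prop
  | src (e : E) : Glue (Sum.inr ⟨e, 0, le_refl 0, (G.len_pos e).le⟩) (Sum.inl (G.src e))
  | tgt (e : E) : Glue (Sum.inr ⟨e, G.len e, (G.len_pos e).le, le_refl _⟩) (Sum.inl (G.tgt e))

/-- The points of the metric graph. -/
def Point : Type _ := Quot G.Glue

/-- A vertex as a point of the graph. -/
def vertex (v : V) : G.Point := Quot.mk _ (Sum.inl v)

/-- The point with coordinate `s` on the edge `e` (meant for `s ∈ [0, len e]`; other values of `s`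
are moved to the nearest end of that interval). -/
noncomputable def pt (e : E) (s : ℝ) : G.Point :=
  Quot.mk _ (Sum.inr ⟨e, Set.projIcc 0 (G.len e) (G.len_pos e).le s⟩)

/-- `G.IsPathLength x y r`: there is a path from `x` to `y` in the graph that consists of finitely
many segments, each contained in an edge, with total length `r`. -/
inductive IsPathLength : G.Point → G.Point → ℝ → Prop
  | refl (x : G.Point) : IsPathLength x x 0
  | step {x : G.Point} {r : ℝ} (e : E) (s t : ℝ) (hs : s ∈ Set.Icc 0 (G.len e))
      (ht : t ∈ Set.Icc 0 (G.len e)) (h : IsPathLength x (G.pt e s) r) :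
      IsPathLength x (G.pt e t) (r + |t - s|)

/-- The graph is connected: any two points (vertices included) are joined by a path. -/
def IsConnected : Prop := ∀ x y : G.Point, ∃ r, G.IsPathLength x y r

/-- The distance of two points: the length of the shortest path between them. -/
noncomputable def pathDist (x y : G.Point) : ℝ := sInf {r | G.IsPathLength x y r}

/-- The diameter: the supremum of the distance over all pairs of points. -/
noncomputable def diam : ℝ := sSup {d | ∃ x y : G.Point, d = G.pathDist x y}

/-- The combinatorial diameter: the maximal distance of two vertices. -/
noncomputable def vertexDiam : ℝ :=
  sSup {d | ∃ u v : V, d = G.pathDist (G.vertex u) (G.vertex v)}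

end MetricGraph

/-- The function `f` on `[0, ℓ]` is (the continuous representative of a function) in `H²(0, ℓ)`,
with first derivative `f'` and second derivative `f''`: both `f` and `f'` are absolutely continuous,
being integrals of `f'` and `f''`, and `f''` is square integrable. -/
structure HasH2Derivs (ℓ : ℝ) (f f' f'' : ℝ → ℂ) : Prop where
  memLp : MemLp f'' 2 (volume.restrict (Set.Icc 0 ℓ))
  first : ∀ x ∈ Set.Icc 0 ℓ, f x = f 0 + ∫ t in (0 : ℝ)..x, f' t
  second : ∀ x ∈ Set.Icc 0 ℓ, f' x = f' 0 + ∫ t in (0 : ℝ)..x, f'' t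

namespace MetricGraph

variable {V E : Type*} [Fintype E] (G : MetricGraph V E)

open Classical in
/-- `G.IsHamiltonian f g`: the function `f` on the graph belongs to the domain of the operator
`L = -d²/dx²` with standard Kirchhoff–Neumann vertex conditions, and `L f = g` in `L²`. That is, on
each edge `f` is in `H²`, the sum of the outgoing derivatives of `f` vanishes at each vertex, and
`-f'' = g` almost everywhere on each edge. Continuity of `f` at the vertices holds because `f` is a
function on the glued space whose restrictions to the closed edges are continuous. -/
def IsHamiltonian (f : G.Point → ℂ) (g : E → ℝ → ℂ) : Prop :=
  ∃ f' f'' : E → ℝ → ℂ,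
    (∀ e, HasH2Derivs (G.len e) (fun s => f (G.pt e s)) (f' e) (f'' e)) ∧
    (∀ v : V, (∑ e : E, if G.src e = v then f' e 0 else 0) +
      (∑ e : E, if G.tgt e = v then -f' e (G.len e) else 0) = 0) ∧
    (∀ e, ∀ᵐ s ∂(volume.restrict (Set.Icc 0 (G.len e))), -f'' e s = g e s)

/-- `lam` is an eigenvalue of `L`: there is a function `f` in its domain, not identically zero on
the edges, with `L f = lam f`. (`L` is self-adjoint, so all of its eigenvalues are real.) -/
def IsEigenvalue (lam : ℝ) : Prop :=
  ∃ f : G.Point → ℂ, (∃ e, ∃ s ∈ Set.Icc 0 (G.len e), f (G.pt e s) ≠ 0) ∧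
    G.IsHamiltonian f (fun e s => (lam : ℂ) * f (G.pt e s))

/-- `lam` is the spectral gap: the lowest nonzero eigenvalue of `L`. -/
def IsSpectralGap (lam : ℝ) : Prop := IsLeast {μ : ℝ | μ ≠ 0 ∧ G.IsEigenvalue μ} lam

end MetricGraph

/-! Upper bound. Take points x, y at distance D > 0, and mark points on the edges so that x, y and
all vertices are break points. Let H equal dist(x, ·) at the break points and be linear in between;
then |H'| ≤ 1, and H has at most n values at the break points, 0 and D among them. Here n = n_V if x
and y are vertices and n = n_V + 2 in general. Put q = D / n and k = π / (2q) = πn / (2D). The trial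
function is φ ∘ H, where φ descends from A to 0 along a quarter cosine on a window [a, a + q], stays
0 up to a later window [b, b + q], and descends there to -B along a quarter sine. A suitable choice
of A and B makes the mean zero, so it remains to see that the integral of k² φ(H)² - (φ'(H) H')² is
nonnegative.

On a piece of slope σ this integral is at least σ times the increment of Φ, a primitive of k² φ² -
φ'², because σ² ≤ 1. Up to monotone terms, which contribute with the right sign, Φ consists of a
positive sine hump on the first window and a negative one on the second. Summation by parts turns
the contribution of a hump into a sum over levels p of its value at p times `outflow`, the total
|slope| of the pieces ending at p from below minus that of the pieces starting at p upwards. It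
suffices that the outflow is ≥ 0 at the levels inside the first window and ≤ 0 at those inside the
second. `exists_two_windows` finds such windows: moving up from 0, skipping a level of the wrong
sign costs less than q, no level is skipped twice, and 0 and D are never skipped. So at most n - 2
skips and two windows fit into nq = D.

Existence of the gap. The direct method maximizes variance over Dirichlet energy
(`exists_maximizer_of_compact`, with compactness from Arzelà–Ascoli). The maximum κ is the Poincaré
constant, a maximizer solves the weak eigenvalue equation with eigenvalue 1/κ
(`isEigenvalue_of_weak`), and the Poincaré inequality forbids smaller nonzero eigenvalues. The
bounds for all pairs x, y then pass to the suprema that define the two diameters. -/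

/-! ### The direct method and integration by parts -/

open Filter Topology in
/-- The direct method for a quadratic form that factors through a compact map: the form attains its
maximum on the unit ball, and a maximizer satisfies the Euler–Lagrange equation. -/
theorem exists_maximizer_of_compact {Y W : Type*} [NormedAddCommGroup Y] [InnerProductSpace ℝ Y]
    [CompleteSpace Y] [NormedAddCommGroup W] [NormedSpace ℝ W] (F : Y →ₗ[ℝ] W) {K : Set W}
    (hK : IsCompact K) (hF : ∀ y, ‖y‖ ≤ 1 → F y ∈ K) (B : W →L[ℝ] W →L[ℝ] ℝ)
    (symm : ∀ v w, B v w = B w v) {y₀ : Y} (hy₀ : 0 < B (F y₀) (F y₀)) :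
    ∃ κ > 0, ∃ y : Y, 0 < B (F y) (F y) ∧ (∀ z, B (F z) (F z) ≤ κ * ‖z‖ ^ 2) ∧
      ∀ z, B (F y) (F z) = κ * inner ℝ y z := by
  obtain ⟨C, hC⟩ := hK.isBounded.exists_norm_le
  -- A linear map that sends the unit ball into a bounded set is continuous.
  obtain ⟨F, rfl⟩ : ∃ F' : Y →L[ℝ] W, (F' : Y →ₗ[ℝ] W) = F := by
    refine ⟨F.mkContinuous C fun y => ?_, rfl⟩
    rcases eq_or_ne y 0 with rfl | hy
    · simp
    have hn : 0 < ‖y‖ := norm_pos_iff.2 hy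
    have h1 := hC _ (hF (‖y‖⁻¹ • y) (by rw [norm_smul, norm_inv, norm_norm, inv_mul_cancel₀ hn.ne']))
    rw [map_smul, norm_smul, norm_inv, norm_norm, inv_mul_le_iff₀ hn] at h1
    linarith
  simp only [ContinuousLinearMap.coe_coe] at *
  set q : Y → ℝ := fun y => B (F y) (F y) with hq
  have hBc : Continuous fun w : W => B w w := by fun_prop
  have hqs : ∀ (t : ℝ) y, q (t • y) = t ^ 2 * q y := fun t y => by
    simp only [hq, map_smul, smul_apply, smul_eq_mul]; ring
  set S := q '' Metric.closedBall 0 1 with hS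
  have hSb : BddAbove S := by
    refine (hK.bddAbove_image hBc.continuousOn).mono ?_
    rintro _ ⟨y, hy, rfl⟩
    exact ⟨F y, hF y (by simpa using hy), rfl⟩
  have hSn : S.Nonempty := ⟨_, 0, by simp, rfl⟩
  set κ := sSup S with hκ
  have hle : ∀ z, q z ≤ κ * ‖z‖ ^ 2 := fun z => by
    rcases eq_or_ne z 0 with rfl | hz
    · simp [hq]
    have hn : 0 < ‖z‖ := norm_pos_iff.2 hz
    have h1 : q (‖z‖⁻¹ • z) ≤ κ := le_csSup hSb
      ⟨_, by simp [norm_smul, inv_mul_cancel₀ hn.ne'], rfl⟩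
    rw [hqs, inv_pow, inv_mul_le_iff₀ (by positivity)] at h1
    linarith
  have hκ0 : 0 < κ := by
    by_contra! h
    have := hle y₀
    nlinarith [sq_nonneg ‖y₀‖]
  obtain ⟨u, -, hu, huS⟩ := exists_seq_tendsto_sSup hSn hSb
  choose y hyb hyu using huS
  have hyb' : ∀ n, ‖y n‖ ≤ 1 := fun n => by simpa using hyb n
  obtain ⟨w, -, ψ, hψ, hw⟩ := hK.tendsto_subseq fun n => hF (y n) (hyb' n)
  have hww : B w w = κ := by
    refine tendsto_nhds_unique ((hBc.tendsto w).comp hw) ?_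
    have := hu.comp hψ.tendsto_atTop
    refine this.congr fun n => ?_
    simp [← hyu, hq]
  set x := fun n => y (ψ n) with hx
  have hxb : ∀ n, ‖x n‖ ≤ 1 := fun n => hyb' _
  -- No weak compactness is needed: by the parallelogram law ‖x_m - x_n‖² ≤ 4 - ‖x_m + x_n‖² ≤ 4 -
  -- q(x_m + x_n) / κ, which tends to 0 because F x_n converges to w with B w w = κ.
  have hcau : CauchySeq x := by
    rw [cauchySeq_iff_tendsto_dist_atTop_0]
    have h1 : Tendsto (fun n : ℕ × ℕ => F (x n.1) + F (x n.2)) atTop (𝓝 (w + w)) := by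
      rw [← prod_atTop_atTop_eq]
      exact (hw.comp tendsto_fst).add (hw.comp tendsto_snd)
    have h2 : Tendsto (fun n : ℕ × ℕ => √(4 - q (x n.1 + x n.2) / κ)) atTop (𝓝 0) := by
      have h3 := ((((hBc.tendsto _).comp h1).div_const κ).const_sub 4).sqrt
      have h4 : √(4 - B (w + w) (w + w) / κ) = 0 := by
        have : B (w + w) (w + w) = 4 * κ := by
          simp only [map_add, add_apply, hww]; ring
        rw [this, mul_div_cancel_right₀ _ hκ0.ne', sub_self, Real.sqrt_zero]
      rw [h4] at h3
      refine h3.congr fun n => ?_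
      simp [hq]
    refine squeeze_zero (fun _ => dist_nonneg) (fun n => ?_) h2
    refine Real.le_sqrt_of_sq_le ?_
    have h5 := parallelogram_law_with_norm ℝ (x n.1) (x n.2)
    have h6 := hle (x n.1 + x n.2)
    have h7 : q (x n.1 + x n.2) / κ ≤ ‖x n.1 + x n.2‖ ^ 2 := by
      rw [div_le_iff₀ hκ0]; linarith
    rw [dist_eq_norm]
    nlinarith [hxb n.1, hxb n.2, norm_nonneg (x n.1), norm_nonneg (x n.2)]
  obtain ⟨z, hz⟩ := cauchySeq_tendsto_of_complete hcau
  have hFz : F z = w := tendsto_nhds_unique ((F.continuous.tendsto z).comp hz) hw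
  have hqz : q z = κ := by simp only [hq, hFz, hww]
  have hz1 : ‖z‖ ≤ 1 := le_of_tendsto hz.norm (Eventually.of_forall hxb)
  have hzz : κ * ‖z‖ ^ 2 = κ := by
    have := hle z
    have : ‖z‖ ^ 2 ≤ 1 := pow_le_one₀ (norm_nonneg _) hz1
    nlinarith
  refine ⟨κ, hκ0, z, by rw [show B (F z) (F z) = κ from hqz]; exact hκ0, hle, fun v => ?_⟩
  -- The nonnegative form κ‖·‖² - q vanishes at z. Along z + t v it is a quadratic polynomial in t
  -- without constant term, so its linear coefficient must be zero.
  have key : ∀ t : ℝ, 0 ≤ (κ * ‖v‖ ^ 2 - q v) * (t * t) + 2 * (κ * inner ℝ z v - B (F z) (F v)) * t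
      + 0 := fun t => by
    have h1 := hle (z + t • v)
    have h2 : q (z + t • v) = q z + 2 * t * B (F z) (F v) + t ^ 2 * q v := by
      simp only [hq, map_add, map_smul, add_apply,
        smul_apply, smul_eq_mul, symm (F v) (F z)]
      ring
    have h3 : ‖z + t • v‖ ^ 2 = ‖z‖ ^ 2 + 2 * t * inner ℝ z v + t ^ 2 * ‖v‖ ^ 2 := by
      rw [norm_add_sq_real, norm_smul, inner_smul_right, mul_pow, Real.norm_eq_abs, sq_abs]
      ring
    rw [h2, h3] at h1
    nlinarith
  have := discrim_le_zero key
  simp only [discrim, mul_zero, sub_zero] at this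
  nlinarith [sq_nonneg (κ * inner ℝ z v - B (F z) (F v))]

/-- Integration by parts for functions that are given as integrals of their derivatives. -/
theorem integral_mul_of_eq_integral {l : ℝ} (hl : 0 ≤ l) {A B g k : ℝ → ℝ}
    (hg : IntervalIntegrable g volume 0 l) (hk : IntervalIntegrable k volume 0 l)
    (hA : ∀ x ∈ Set.Icc 0 l, A x = A 0 + ∫ t in (0 : ℝ)..x, g t)
    (hB : ∀ x ∈ Set.Icc 0 l, B x = B 0 + ∫ t in (0 : ℝ)..x, k t) :
    ∫ x in (0 : ℝ)..l, A x * k x = A l * B l - A 0 * B 0 - ∫ x in (0 : ℝ)..l, g x * B x := by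
  set A' : ℝ → ℝ := fun x => A 0 + ∫ t in (0 : ℝ)..x, g t with hA'
  set B' : ℝ → ℝ := fun x => B 0 + ∫ t in (0 : ℝ)..x, k t with hB'
  have h0 : (0 : ℝ) ∈ Set.uIcc 0 l := Set.left_mem_uIcc
  have hcst : ∀ c : ℝ, AbsolutelyContinuousOnInterval (fun _ => c) 0 l := fun c =>
    (LipschitzWith.const c).lipschitzOnWith.absolutelyContinuousOnInterval
  have hAac : AbsolutelyContinuousOnInterval A' 0 l :=
    (hcst _).fun_add (hg.absolutelyContinuousOnInterval_intervalIntegral h0)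
  have hBac : AbsolutelyContinuousOnInterval B' 0 l :=
    (hcst _).fun_add (hk.absolutelyContinuousOnInterval_intervalIntegral h0)
  have hu : Set.uIoc 0 l ⊆ Set.uIcc 0 l := Set.uIoc_subset_uIcc
  have key := hAac.integral_mul_deriv_eq_deriv_mul hBac
  rw [Set.uIcc_of_le hl] at hu h0
  have e1 : ∫ x in (0 : ℝ)..l, A' x * deriv B' x = ∫ x in (0 : ℝ)..l, A x * k x := by
    refine intervalIntegral.integral_congr_ae ?_
    filter_upwards [hk.ae_hasDerivAt_integral] with x hx hxm
    rw [((hx (Set.uIoc_subset_uIcc hxm) 0 Set.left_mem_uIcc).const_add (B 0)).deriv,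
      hA x (hu hxm)]
  have e2 : ∫ x in (0 : ℝ)..l, deriv A' x * B' x = ∫ x in (0 : ℝ)..l, g x * B x := by
    refine intervalIntegral.integral_congr_ae ?_
    filter_upwards [hg.ae_hasDerivAt_integral] with x hx hxm
    rw [((hx (Set.uIoc_subset_uIcc hxm) 0 Set.left_mem_uIcc).const_add (A 0)).deriv,
      hB x (hu hxm)]
  rw [e1, e2] at key
  rw [key, hA l ⟨hl, le_rfl⟩, hB l ⟨hl, le_rfl⟩]
  simp [hA', hB']

/-! ### Combinatorics of windows that avoid marked levels -/

/-- Skipping finitely many obstacles at a cost of less than `q` each, one reaches a window of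
length `q` without obstacles. -/
theorem exists_window (S : Finset ℝ) {q : ℝ} (x : ℝ) :
    ∃ a, x ≤ a ∧ (∀ p ∈ S, ¬(a < p ∧ p < a + q)) ∧
      a ≤ x + q * (S.filter fun p => x < p ∧ p ≤ a).card := by
  induction hn : (S.filter fun p => x < p).card using Nat.strong_induction_on generalizing x with
  | _ n ih =>
    subst hn
    by_cases h : ∃ p ∈ S, x < p ∧ p < x + q
    -- Restart at the obstacle p. This costs p - x < q, and p pays for it: it is counted in (x, a]
    -- but not in (p, a].
    · obtain ⟨p, hpS, hxp, hpq⟩ := h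
      obtain ⟨a, hpa, hw, ha⟩ := ih _ (Finset.card_lt_card (by
        refine ⟨fun y hy => ?_, fun hsub => ?_⟩
        · simp only [Finset.mem_filter] at hy ⊢
          exact ⟨hy.1, hxp.trans hy.2⟩
        · have := hsub (show p ∈ S.filter fun p => x < p by simp [hpS, hxp])
          simp at this)) p rfl
      refine ⟨a, hxp.le.trans hpa, hw, ?_⟩
      have hcard : (S.filter fun y => p < y ∧ y ≤ a).card + 1
          ≤ (S.filter fun y => x < y ∧ y ≤ a).card := by
        rw [← Finset.card_insert_of_notMem (a := p) (by simp)]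
        refine Finset.card_le_card fun y hy => ?_
        simp only [Finset.mem_insert, Finset.mem_filter] at hy ⊢
        rcases hy with rfl | hy
        · exact ⟨hpS, hxp, hpa⟩
        · exact ⟨hy.1, hxp.trans hy.2.1, hy.2.2⟩
      have hq : 0 < q := by linarith
      have : ((S.filter fun y => p < y ∧ y ≤ a).card : ℝ) + 1
          ≤ (S.filter fun y => x < y ∧ y ≤ a).card := by exact_mod_cast hcard
      nlinarith
    · push Not at h
      exact ⟨x, le_rfl, fun p hp hpx => absurd (h p hp hpx.1) (not_le.2 hpx.2), by
        rw [Finset.filter_eq_empty_iff.2 fun p _ hp => absurd hp.1 (not_lt.2 hp.2)]; simp⟩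

/-- Among finitely many marks in `[0, n q]`, each of which has one of two signs, there are two
disjoint windows of length `q`, the first without marks of positive and the second without marks
of negative sign. -/
theorem exists_two_windows (J : Finset ℝ) (δ : ℝ → ℝ) {D q : ℝ} (hD : 0 < D) (h0 : 0 ∈ J)
    (hDJ : D ∈ J) {n : ℕ} (hJ : J.card ≤ n) (hq : D = n * q) :
    ∃ a b, 0 ≤ a ∧ a + q ≤ b ∧ b + q ≤ D ∧ (∀ p ∈ J, a < p → p < a + q → 0 ≤ δ p) ∧
      ∀ p ∈ J, b < p → p < b + q → δ p ≤ 0 := by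
  have hq0 : 0 < q := by
    by_contra! h
    have : (n : ℝ) * q ≤ 0 := mul_nonpos_of_nonneg_of_nonpos n.cast_nonneg h
    linarith
  obtain ⟨a, ha0, haw, ha⟩ := exists_window (J.filter fun p => p < D ∧ δ p < 0) (q := q) 0
  obtain ⟨b, hab, hbw, hb⟩ := exists_window (J.filter fun p => p < D ∧ 0 < δ p) (q := q) (a + q)
  set U := (J.filter fun p => p < D ∧ δ p < 0).filter fun p => 0 < p ∧ p ≤ a with hU
  set W := (J.filter fun p => p < D ∧ 0 < δ p).filter fun p => a + q < p ∧ p ≤ b with hW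
  -- The skipped levels lie in (0, a] and in (a + q, b] and are different from D, so U, W and {0, D}
  -- are disjoint subsets of J.
  have hcard : U.card + W.card + 2 ≤ n := by
    rw [← Finset.card_union_of_disjoint, ← Finset.card_pair hD.ne,
      ← Finset.card_union_of_disjoint]
    · refine (Finset.card_le_card fun p hp => ?_).trans hJ
      simp only [hU, hW, Finset.mem_union, Finset.mem_filter, Finset.mem_insert,
        Finset.mem_singleton] at hp
      rcases hp with (hp | hp) | rfl | rfl
      exacts [hp.1.1, hp.1.1, h0, hDJ]
    · rw [Finset.disjoint_left]
      intro p hp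
      simp only [hU, hW, Finset.mem_union, Finset.mem_filter, Finset.mem_insert,
        Finset.mem_singleton] at hp ⊢
      rintro (rfl | rfl)
      · rcases hp with hp | hp
        · exact lt_irrefl _ hp.2.1
        · linarith [hp.2.1]
      · rcases hp with hp | hp
        exacts [lt_irrefl _ hp.1.2.1, lt_irrefl _ hp.1.2.1]
    · rw [Finset.disjoint_left]
      intro p hp hp'
      simp only [hU, hW, Finset.mem_filter] at hp hp'
      linarith [hp.1.2.2, hp'.1.2.2]
  have hcard' : (U.card : ℝ) + W.card + 2 ≤ n := by exact_mod_cast hcard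
  -- The cost is b + q ≤ q (#U + 1 + #W + 1) ≤ n q.
  have hbD : b + q ≤ D := by
    rw [hq]
    nlinarith
  refine ⟨a, b, ha0, hab, hbD, fun p hp h1 h2 => ?_, fun p hp h1 h2 => ?_⟩
  · by_contra! h
    exact haw p (by simp only [Finset.mem_filter]; exact ⟨hp, by linarith, h⟩) ⟨h1, h2⟩
  · by_contra! h
    exact hbw p (by simp only [Finset.mem_filter]; exact ⟨hp, by linarith, h⟩) ⟨h1, h2⟩

/-! ### The trial profile on the line -/

open Classical in
/-- The indicator function of an open interval. -/
noncomputable def windowIndicator (a q t : ℝ) : ℝ := if a < t ∧ t < a + q then 1 else 0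

/-- A phase that increases linearly from `0` to `π / 2` on `[a, a + q]` and is constant elsewhere. -/
noncomputable def windowPhase (a q t : ℝ) : ℝ := Real.pi / (2 * q) * max 0 (min q (t - a))

/-- The trial profile: it descends from `A` to `0` along a quarter of a cosine wave on
`[a, a + q]`, and from `0` to `-B` along a quarter of a sine wave on `[b, b + q]`. -/
noncomputable def profile (A B a b q t : ℝ) : ℝ :=
  A * Real.cos (windowPhase a q t) - B * Real.sin (windowPhase b q t)

/-- The derivative of the trial profile. -/
noncomputable def profileDeriv (A B a b q t : ℝ) : ℝ :=
  -A * Real.sin (windowPhase a q t) * (Real.pi / (2 * q) * windowIndicator a q t) -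
    B * Real.cos (windowPhase b q t) * (Real.pi / (2 * q) * windowIndicator b q t)

/-- A primitive of the difference of the squares of the profile, suitably scaled, and of its
derivative. -/
noncomputable def profilePrimitive (A B a b q t : ℝ) : ℝ :=
  A ^ 2 * ((Real.pi / (2 * q)) ^ 2 * min t a +
      Real.pi / (2 * q) / 2 * Real.sin (2 * windowPhase a q t)) +
    B ^ 2 * ((Real.pi / (2 * q)) ^ 2 * max (t - (b + q)) 0 -
      Real.pi / (2 * q) / 2 * Real.sin (2 * windowPhase b q t))

theorem continuous_windowPhase (a q : ℝ) : Continuous (windowPhase a q) := by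
  unfold windowPhase; fun_prop

theorem continuous_profile (A B a b q : ℝ) : Continuous (profile A B a b q) := by
  have := continuous_windowPhase a q
  have := continuous_windowPhase b q
  unfold profile; fun_prop

theorem continuous_profilePrimitive (A B a b q : ℝ) :
    Continuous (profilePrimitive A B a b q) := by
  have := continuous_windowPhase a q
  have := continuous_windowPhase b q
  unfold profilePrimitive; fun_prop

theorem measurable_windowIndicator (a q : ℝ) : Measurable (windowIndicator a q) := by
  unfold windowIndicator
  exact Measurable.ite (measurableSet_Ioo (a := a) (b := a + q)) measurable_const measurable_const

theorem measurable_profileDeriv (A B a b q : ℝ) : Measurable (profileDeriv A B a b q) := by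
  have h1 := (continuous_windowPhase a q).measurable
  have h2 := (continuous_windowPhase b q).measurable
  have := measurable_windowIndicator a q
  have := measurable_windowIndicator b q
  unfold profileDeriv; fun_prop

theorem abs_windowIndicator_le (a q t : ℝ) : |windowIndicator a q t| ≤ 1 := by
  unfold windowIndicator; split_ifs <;> simp

theorem abs_profileDeriv_le (A B a b : ℝ) {q : ℝ} (hq : 0 < q) (t : ℝ) :
    |profileDeriv A B a b q t| ≤ (|A| + |B|) * (Real.pi / (2 * q)) := by
  have hk : 0 < Real.pi / (2 * q) := by positivity
  unfold profileDeriv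
  refine (abs_sub _ _).trans ?_
  simp only [abs_mul, abs_neg, abs_of_pos hk]
  have h1 := mul_le_mul (Real.abs_sin_le_one (windowPhase a q t)) (abs_windowIndicator_le a q t)
    (abs_nonneg _) zero_le_one
  have h2 := mul_le_mul (Real.abs_cos_le_one (windowPhase b q t)) (abs_windowIndicator_le b q t)
    (abs_nonneg _) zero_le_one
  rw [mul_one] at h1 h2
  have h3 := mul_le_mul_of_nonneg_left h1 (mul_nonneg (abs_nonneg A) hk.le)
  have h4 := mul_le_mul_of_nonneg_left h2 (mul_nonneg (abs_nonneg B) hk.le)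
  nlinarith

section phase
variable {a q t : ℝ}

theorem windowPhase_of_le (hq : 0 < q) (h : t ≤ a) : windowPhase a q t = 0 := by
  rw [windowPhase, min_eq_right (by linarith), max_eq_left (by linarith), mul_zero]

theorem windowPhase_of_ge (hq : 0 < q) (h : a + q ≤ t) : windowPhase a q t = Real.pi / 2 := by
  rw [windowPhase, min_eq_left (by linarith), max_eq_right hq.le]
  field_simp

theorem windowPhase_nonneg (hq : 0 < q) : 0 ≤ windowPhase a q t := by
  unfold windowPhase; positivity

theorem windowPhase_le (hq : 0 < q) : windowPhase a q t ≤ Real.pi / 2 := by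
  rw [windowPhase, show Real.pi / 2 = Real.pi / (2 * q) * q by field_simp]
  have : 0 < Real.pi / (2 * q) := by positivity
  gcongr
  exact max_le hq.le (min_le_left _ _)

theorem windowPhase_lt (hq : 0 < q) (h : t < a + q) : windowPhase a q t < Real.pi / 2 := by
  rw [windowPhase, show Real.pi / 2 = Real.pi / (2 * q) * q by field_simp]
  have : 0 < Real.pi / (2 * q) := by positivity
  gcongr
  exact max_lt hq ((min_le_right _ _).trans_lt (by linarith))

theorem windowPhase_pos (hq : 0 < q) (h : a < t) : 0 < windowPhase a q t := by
  unfold windowPhase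
  have : 0 < Real.pi / (2 * q) := by positivity
  exact mul_pos this (lt_max_of_lt_right (lt_min hq (by linarith)))

theorem hasDerivAt_windowPhase (hq : 0 < q) (ha : t ≠ a) (hb : t ≠ a + q) :
    HasDerivAt (windowPhase a q) (Real.pi / (2 * q) * windowIndicator a q t) t := by
  rcases lt_or_gt_of_ne ha with h | h
  · rw [windowIndicator, if_neg fun h' => absurd h'.1 (not_lt.2 h.le), mul_zero]
    refine (hasDerivAt_const t (0 : ℝ)).congr_of_eventuallyEq ?_
    filter_upwards [eventually_lt_nhds h] with s hs using windowPhase_of_le hq hs.le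
  rcases lt_or_gt_of_ne hb with h' | h'
  · rw [windowIndicator, if_pos ⟨h, h'⟩]
    refine (((hasDerivAt_id t).sub_const a).const_mul _).congr_of_eventuallyEq ?_
    filter_upwards [eventually_lt_nhds h', eventually_gt_nhds h] with s hs hs'
    rw [windowPhase, min_eq_right (by linarith), max_eq_right (by linarith)]
    rfl
  · rw [windowIndicator, if_neg fun h'' => absurd h''.2 (not_lt.2 h'.le), mul_zero]
    refine (hasDerivAt_const t (Real.pi / 2)).congr_of_eventuallyEq ?_
    filter_upwards [eventually_gt_nhds h'] with s hs using windowPhase_of_ge hq hs.le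

end phase

variable {A B a b q : ℝ}

theorem hasDerivAt_profile {t : ℝ} (hq : 0 < q) (ht : t ∉ ({a, a + q, b, b + q} : Set ℝ)) :
    HasDerivAt (profile A B a b q) (profileDeriv A B a b q t) t := by
  simp only [Set.mem_insert_iff, Set.mem_singleton_iff, not_or] at ht
  have h1 := (hasDerivAt_windowPhase hq ht.1 ht.2.1).cos.const_mul A
  have h2 := (hasDerivAt_windowPhase hq ht.2.2.1 ht.2.2.2).sin.const_mul B
  refine (h1.sub h2).congr_deriv ?_
  simp only [profileDeriv]; ring

/-- With k = π / (2q) and θ the phase, the difference is A² k² cos 2θ on the first window and -B² k²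
cos 2θ on the second, which gives the sine terms. It is A² k² left of a and B² k² right of b + q,
which gives the terms with `min` and `max`, and it is zero between the windows. -/
theorem hasDerivAt_profilePrimitive {t : ℝ} (hq : 0 < q) (hab : a + q ≤ b)
    (ht : t ∉ ({a, a + q, b, b + q} : Set ℝ)) :
    HasDerivAt (profilePrimitive A B a b q)
      ((Real.pi / (2 * q)) ^ 2 * profile A B a b q t ^ 2 - profileDeriv A B a b q t ^ 2) t := by
  simp only [Set.mem_insert_iff, Set.mem_singleton_iff, not_or] at ht
  obtain ⟨h1, h2, h3, h4⟩ := ht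
  set k := Real.pi / (2 * q) with hk
  have hA := ((hasDerivAt_windowPhase hq h1 h2).const_mul 2).sin.const_mul (k / 2)
  have hB := ((hasDerivAt_windowPhase hq h3 h4).const_mul 2).sin.const_mul (k / 2)
  have hm : HasDerivAt (fun t => min t a) (if t < a then 1 else 0) t := by
    rcases lt_or_gt_of_ne h1 with h | h
    · rw [if_pos h]
      refine (hasDerivAt_id t).congr_of_eventuallyEq ?_
      filter_upwards [eventually_lt_nhds h] with s hs using min_eq_left hs.le
    · rw [if_neg h.not_gt]
      refine (hasDerivAt_const t a).congr_of_eventuallyEq ?_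
      filter_upwards [eventually_gt_nhds h] with s hs using min_eq_right hs.le
  have hM : HasDerivAt (fun t => max (t - (b + q)) 0) (if b + q < t then 1 else 0) t := by
    rcases lt_or_gt_of_ne h4 with h | h
    · rw [if_neg h.not_gt]
      refine (hasDerivAt_const t (0 : ℝ)).congr_of_eventuallyEq ?_
      filter_upwards [eventually_lt_nhds h] with s hs using max_eq_right (by linarith)
    · rw [if_pos h]
      refine ((hasDerivAt_id t).sub_const (b + q)).congr_of_eventuallyEq ?_
      filter_upwards [eventually_gt_nhds h] with s hs using max_eq_left (by linarith)
  refine ((((hm.const_mul (k ^ 2)).add hA).const_mul (A ^ 2)).add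
    (((hM.const_mul (k ^ 2)).sub hB).const_mul (B ^ 2))).congr_deriv ?_
  simp only [profile, profileDeriv, ← hk, windowIndicator]
  have hsin := Real.sin_sq_add_cos_sq (windowPhase a q t)
  have hsin' := Real.sin_sq_add_cos_sq (windowPhase b q t)
  rw [Real.cos_two_mul, Real.cos_two_mul]
  rcases lt_or_gt_of_ne h1 with c1 | c1
  · rw [windowPhase_of_le hq c1.le, windowPhase_of_le hq (show t ≤ b by linarith), if_pos c1,
      if_neg (by rintro ⟨_, _⟩; linarith), if_neg (by linarith), if_neg (by rintro ⟨_, _⟩; linarith)]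
    simp; ring
  rcases lt_or_gt_of_ne h2 with c2 | c2
  · rw [windowPhase_of_le hq (show t ≤ b by linarith), if_neg c1.not_gt,
      if_pos ⟨c1, c2⟩, if_neg (by linarith), if_neg (by rintro ⟨_, _⟩; linarith)]
    simp
    linear_combination (k ^ 2 * A ^ 2) * hsin
  rcases lt_or_gt_of_ne h3 with c3 | c3
  · rw [windowPhase_of_le hq c3.le, windowPhase_of_ge hq c2.le, if_neg c1.not_gt,
      if_neg (by rintro ⟨_, _⟩; linarith), if_neg (by linarith), if_neg (by rintro ⟨_, _⟩; linarith)]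
    simp
  rcases lt_or_gt_of_ne h4 with c4 | c4
  · rw [windowPhase_of_ge hq c2.le, if_neg c1.not_gt,
      if_neg (by rintro ⟨_, _⟩; linarith), if_neg (by linarith), if_pos ⟨c3, c4⟩]
    simp
    linear_combination (-k ^ 2 * B ^ 2) * hsin'
  · rw [windowPhase_of_ge hq c2.le, windowPhase_of_ge hq c4.le, if_neg c1.not_gt,
      if_neg (by rintro ⟨_, _⟩; linarith), if_pos c4, if_neg (by rintro ⟨_, _⟩; linarith)]
    simp; ring

theorem countable_windowEnds (a b q : ℝ) : ({a, a + q, b, b + q} : Set ℝ).Countable :=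
  (Set.toFinite _).countable

theorem integrable_comp_profileDeriv (hq : 0 < q) {H : ℝ → ℝ} (hH : Measurable H) (x y : ℝ) :
    IntervalIntegrable (fun t => profileDeriv A B a b q (H t)) volume x y :=
  (intervalIntegrable_const (c := (|A| + |B|) * (Real.pi / (2 * q)))).mono_fun
    ((measurable_profileDeriv A B a b q).comp hH).aestronglyMeasurable
    (Filter.Eventually.of_forall fun _ => (abs_profileDeriv_le A B a b hq _).trans (le_abs_self _))

theorem integrable_comp_profileDeriv_sq (hq : 0 < q) {H : ℝ → ℝ} (hH : Measurable H) (x y : ℝ) :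
    IntervalIntegrable (fun t => profileDeriv A B a b q (H t) ^ 2) volume x y :=
  (intervalIntegrable_const (c := ((|A| + |B|) * (Real.pi / (2 * q))) ^ 2)).mono_fun
    (((measurable_profileDeriv A B a b q).comp hH).pow_const 2).aestronglyMeasurable
    (Filter.Eventually.of_forall fun t => by
      simp only [norm_pow, Real.norm_eq_abs]
      exact pow_le_pow_left₀ (abs_nonneg _)
        ((abs_profileDeriv_le A B a b hq _).trans (le_abs_self _)) 2)

theorem integral_profileDeriv (hq : 0 < q) (x y : ℝ) :
    ∫ t in x..y, profileDeriv A B a b q t = profile A B a b q y - profile A B a b q x :=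
  integral_eq_of_hasDerivAt_off_countable _ _ (countable_windowEnds a b q)
    (continuous_profile A B a b q).continuousOn (fun _ ht => hasDerivAt_profile hq ht.2)
    (integrable_comp_profileDeriv hq measurable_id x y)

theorem integral_profile_sq_sub (hq : 0 < q) (hab : a + q ≤ b) (x y : ℝ) :
    ∫ t in x..y, ((Real.pi / (2 * q)) ^ 2 * profile A B a b q t ^ 2 - profileDeriv A B a b q t ^ 2)
      = profilePrimitive A B a b q y - profilePrimitive A B a b q x := by
  refine integral_eq_of_hasDerivAt_off_countable _ _ (countable_windowEnds a b q)
    (continuous_profilePrimitive A B a b q).continuousOn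
    (fun _ ht => hasDerivAt_profilePrimitive hq hab ht.2)
    (IntervalIntegrable.sub ?_ (integrable_comp_profileDeriv_sq hq measurable_id x y))
  have := continuous_profile A B a b q
  exact Continuous.intervalIntegrable (by fun_prop) _ _

/-! ### Primitives of square integrable functions -/

/-- Integration from `0` to `s` as a functional on `L²(0, l)`. -/
noncomputable def primitiveL2 (l s : ℝ) : Lp ℝ 2 (volume.restrict (Set.Icc 0 l)) →L[ℝ] ℝ :=
  innerSL ℝ (indicatorConstLp 2 (measurableSet_Ioc (a := (0 : ℝ)) (b := s))
    (measure_ne_top _ _) 1)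

section primitive
variable {l : ℝ}

theorem integral_Ioc_restrict_Icc {s t : ℝ} (hs : 0 ≤ s) (hst : s ≤ t) (ht : t ≤ l) (g : ℝ → ℝ) :
    ∫ x in Set.Ioc s t, g x ∂(volume.restrict (Set.Icc 0 l)) = ∫ x in s..t, g x := by
  rw [Measure.restrict_restrict measurableSet_Ioc, Set.inter_eq_left.2,
    intervalIntegral.integral_of_le hst]
  exact fun x hx => ⟨hs.trans hx.1.le, hx.2.trans ht⟩

theorem primitiveL2_apply {s : ℝ} (hs : s ∈ Set.Icc 0 l)
    (g : Lp ℝ 2 (volume.restrict (Set.Icc 0 l))) :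
    primitiveL2 l s g = ∫ t in (0 : ℝ)..s, g t := by
  rw [primitiveL2, innerSL_apply_apply, L2.inner_indicatorConstLp_one,
    integral_Ioc_restrict_Icc le_rfl hs.1 hs.2]

theorem MeasureTheory.MemLp.intervalIntegrable_of_restrict_Icc {F : Type*} [NormedAddCommGroup F]
    {g : ℝ → F} (hg : MemLp g 2 (volume.restrict (Set.Icc 0 l))) {s t : ℝ}
    (hs : s ∈ Set.Icc 0 l) (ht : t ∈ Set.Icc 0 l) : IntervalIntegrable g volume s t := by
  have : IntegrableOn g (Set.Icc 0 l) := hg.integrable (by norm_num)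
  exact (this.mono_set (Set.uIcc_subset_Icc hs ht)).intervalIntegrable

/-- Cauchy–Schwarz against the indicator of (t, s]. This Hölder bound of exponent 1/2 is the source
of equicontinuity. -/
theorem abs_primitiveL2_sub_le {s t : ℝ} (hs : s ∈ Set.Icc 0 l) (ht : t ∈ Set.Icc 0 l)
    (g : Lp ℝ 2 (volume.restrict (Set.Icc 0 l))) :
    |primitiveL2 l s g - primitiveL2 l t g| ≤ √|s - t| * ‖g‖ := by
  wlog h : t ≤ s generalizing s t
  · rw [abs_sub_comm, abs_sub_comm s]
    exact this ht hs (le_of_not_ge h)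
  have hg := Lp.memLp g
  have h0 : (0 : ℝ) ∈ Set.Icc 0 l := ⟨le_rfl, hs.1.trans hs.2⟩
  rw [primitiveL2_apply hs, primitiveL2_apply ht,
    intervalIntegral.integral_interval_sub_left (hg.intervalIntegrable_of_restrict_Icc h0 hs)
      (hg.intervalIntegrable_of_restrict_Icc h0 ht), ← integral_Ioc_restrict_Icc ht.1 h hs.2,
    ← L2.inner_indicatorConstLp_one measurableSet_Ioc (measure_ne_top _ _)]
  refine (abs_real_inner_le_norm _ _).trans (mul_le_mul_of_nonneg_right ?_ (norm_nonneg _))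
  refine norm_indicatorConstLp_le.trans ?_
  rw [norm_one, one_mul, Real.sqrt_eq_rpow]
  simp only [ENNReal.toReal_ofNat]
  refine Real.rpow_le_rpow measureReal_nonneg ?_ (by norm_num)
  rw [abs_of_nonneg (sub_nonneg.2 h), ← Real.volume_real_Ioc_of_le h]
  exact ENNReal.toReal_mono (by simp) (Measure.restrict_le_self _)

theorem continuous_primitiveL2 (g : Lp ℝ 2 (volume.restrict (Set.Icc 0 l))) :
    Continuous fun s : Set.Icc 0 l => primitiveL2 l s g := by
  rw [continuous_iff_continuousAt]
  intro s
  rw [ContinuousAt, tendsto_iff_dist_tendsto_zero]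
  refine squeeze_zero (g := fun t : Set.Icc 0 l => √|(t : ℝ) - s| * ‖g‖) (fun _ => dist_nonneg)
    (fun t => by rw [Real.dist_eq]; exact abs_primitiveL2_sub_le t.2 s.2 g) ?_
  have : Continuous fun t : Set.Icc 0 l => √|(t : ℝ) - s| * ‖g‖ := by fun_prop
  simpa using this.tendsto s

end primitive

/-! ### H¹ functions and integrals over the edges -/

namespace MetricGraph

variable {V E : Type*} (G : MetricGraph V E)

/-- `f` is an `H¹` function on the graph with vertex values `a` and derivative `g`. -/
structure IsH1 (a : V → ℝ) (f g : E → ℝ → ℝ) : Prop where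
  memLp : ∀ e, MemLp (g e) 2 (volume.restrict (Set.Icc 0 (G.len e)))
  src : ∀ e, f e 0 = a (G.src e)
  tgt : ∀ e, f e (G.len e) = a (G.tgt e)
  integral : ∀ e, ∀ x ∈ Set.Icc 0 (G.len e), f e x = f e 0 + ∫ t in (0 : ℝ)..x, g e t

/-- The integral of a function over all edges. -/
noncomputable def edgeIntegral [Fintype E] (f : E → ℝ → ℝ) : ℝ :=
  ∑ e, ∫ t in (0 : ℝ)..G.len e, f e t

/-- The total length of the graph. -/
noncomputable def totalLength [Fintype E] : ℝ := ∑ e, G.len e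

/-- The squared `L²` distance of a function on the graph to the constants. -/
noncomputable def variance [Fintype E] (f : E → ℝ → ℝ) : ℝ :=
  G.edgeIntegral (fun e t => f e t * f e t) - G.edgeIntegral f * G.edgeIntegral f / G.totalLength

variable {G}

theorem IsH1.continuousOn {a : V → ℝ} {f g : E → ℝ → ℝ} (h : G.IsH1 a f g) (e : E) :
    ContinuousOn (f e) (Set.Icc 0 (G.len e)) := by
  have hl := (G.len_pos e).le
  have h0 : IntegrableOn (g e) (Set.uIcc 0 (G.len e)) := by
    rw [Set.uIcc_of_le hl]; exact (h.memLp e).integrable (by norm_num)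
  have := (intervalIntegral.continuousOn_primitive_interval h0).const_add (f e 0)
  rw [Set.uIcc_of_le hl] at this
  exact this.congr (h.integral e)

theorem IsH1.intervalIntegrable {a : V → ℝ} {f g : E → ℝ → ℝ} (h : G.IsH1 a f g) (e : E) :
    IntervalIntegrable (f e) volume 0 (G.len e) :=
  ContinuousOn.intervalIntegrable_of_Icc (G.len_pos e).le (h.continuousOn e)

theorem IsH1.intervalIntegrable_deriv {a : V → ℝ} {f g : E → ℝ → ℝ} (h : G.IsH1 a f g) (e : E) :
    IntervalIntegrable (g e) volume 0 (G.len e) :=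
  (h.memLp e).intervalIntegrable_of_restrict_Icc ⟨le_rfl, (G.len_pos e).le⟩
    ⟨(G.len_pos e).le, le_rfl⟩

theorem IsH1.add_const {a : V → ℝ} {f g : E → ℝ → ℝ} (h : G.IsH1 a f g) (c : ℝ) :
    G.IsH1 (fun v => a v + c) (fun e t => f e t + c) g :=
  ⟨h.memLp, fun e => by rw [h.src], fun e => by rw [h.tgt],
    fun e x hx => by rw [h.integral e x hx]; ring⟩

/-- On a connected graph, a function on the vertices that agrees at the ends of each edge is
constant. -/
theorem IsConnected.eq_of_src_eq_tgt (hG : G.IsConnected) {a : V → ℝ}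
    (ha : ∀ e, a (G.src e) = a (G.tgt e)) (u v : V) : a u = a v := by
  -- Extended along each edge by the common value at its ends, the function descends to the glued
  -- space and is preserved by every step of a path.
  let k : G.Point → ℝ := Quot.lift (Sum.elim a fun p => a (G.src p.1)) (by
    rintro _ _ (e | e)
    · rfl
    · exact ha e)
  obtain ⟨r, hr⟩ := hG (G.vertex u) (G.vertex v)
  have : ∀ x y r, G.IsPathLength x y r → k x = k y := by
    intro x y r h
    induction h with
    | refl => rfl
    | step e s t hs ht _ ih => exact ih
  exact this _ _ r hr

variable [Fintype E]

theorem edgeIntegral_congr {f f' : E → ℝ → ℝ}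
    (h : ∀ e, ∀ x ∈ Set.Icc 0 (G.len e), f e x = f' e x) :
    G.edgeIntegral f = G.edgeIntegral f' :=
  Finset.sum_congr rfl fun e _ => intervalIntegral.integral_congr fun x hx =>
    h e x (by rwa [Set.uIcc_of_le (G.len_pos e).le] at hx)

theorem edgeIntegral_add {f f' : E → ℝ → ℝ}
    (h : ∀ e, IntervalIntegrable (f e) volume 0 (G.len e))
    (h' : ∀ e, IntervalIntegrable (f' e) volume 0 (G.len e)) :
    G.edgeIntegral (fun e t => f e t + f' e t) = G.edgeIntegral f + G.edgeIntegral f' := by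
  rw [edgeIntegral, edgeIntegral, edgeIntegral, ← Finset.sum_add_distrib]
  exact Finset.sum_congr rfl fun e _ => intervalIntegral.integral_add (h e) (h' e)

theorem edgeIntegral_const_mul (c : ℝ) (f : E → ℝ → ℝ) :
    G.edgeIntegral (fun e t => c * f e t) = c * G.edgeIntegral f := by
  simp only [edgeIntegral, intervalIntegral.integral_const_mul, Finset.mul_sum]

theorem edgeIntegral_const (c : ℝ) : G.edgeIntegral (fun _ _ => c) = c * G.totalLength := by
  simp [edgeIntegral, totalLength, Finset.mul_sum, mul_comm]

theorem edgeIntegral_add_const_mul_add_const {f f' : E → ℝ → ℝ}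
    (h : ∀ e, ContinuousOn (f e) (Set.Icc 0 (G.len e)))
    (h' : ∀ e, ContinuousOn (f' e) (Set.Icc 0 (G.len e))) (c d : ℝ) :
    G.edgeIntegral (fun e t => (f e t + c) * (f' e t + d)) =
      G.edgeIntegral (fun e t => f e t * f' e t) + d * G.edgeIntegral f + c * G.edgeIntegral f' +
        c * d * G.totalLength := by
  have i : ∀ {k : E → ℝ → ℝ}, (∀ e, ContinuousOn (k e) (Set.Icc 0 (G.len e))) →
      ∀ e, IntervalIntegrable (k e) volume 0 (G.len e) := fun hk e =>
    ContinuousOn.intervalIntegrable_of_Icc (G.len_pos e).le (hk e)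
  have e1 : (fun e t => (f e t + c) * (f' e t + d)) = fun e t =>
      ((f e t * f' e t + d * f e t) + c * f' e t) + c * d := by ext e t; ring
  rw [e1, edgeIntegral_add, edgeIntegral_add, edgeIntegral_add, edgeIntegral_const_mul,
    edgeIntegral_const_mul, edgeIntegral_const]
  · exact i fun e => (h e).mul (h' e)
  · exact i fun e => (h e).const_mul d
  · exact i fun e => ((h e).mul (h' e)).add ((h e).const_mul d)
  · exact i fun e => (h' e).const_mul c
  · exact i fun e => (((h e).mul (h' e)).add ((h e).const_mul d)).add ((h' e).const_mul c)
  · exact fun e => intervalIntegrable_const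

theorem edgeIntegral_add_const {f : E → ℝ → ℝ}
    (h : ∀ e, ContinuousOn (f e) (Set.Icc 0 (G.len e))) (c : ℝ) :
    G.edgeIntegral (fun e t => f e t + c) = G.edgeIntegral f + c * G.totalLength := by
  rw [edgeIntegral_add (fun e => ContinuousOn.intervalIntegrable_of_Icc (G.len_pos e).le (h e))
    (fun e => intervalIntegrable_const), edgeIntegral_const]

end MetricGraph

/-! ### The Hilbert space of gradients and compactness -/

namespace MetricGraph

variable {V E : Type*} (G : MetricGraph V E)

/-- The disjoint union of the closed edges. -/
abbrev EdgePoint : Type _ := Σ e : E, Set.Icc (0 : ℝ) (G.len e)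

/-- The edge functions of a function on the disjoint union of the edges. -/
noncomputable def extend (p : G.EdgePoint → ℝ) (e : E) (t : ℝ) : ℝ :=
  p ⟨e, Set.projIcc 0 (G.len e) (G.len_pos e).le t⟩

/-- The space of square integrable functions on the edges. -/
abbrev EdgeL2 : Type _ := PiLp 2 fun e => Lp ℝ 2 (volume.restrict (Set.Icc 0 (G.len e)))

/-- The coboundary operator of the underlying combinatorial graph. -/
def coboundary : (V → ℝ) →ₗ[ℝ] (E → ℝ) where
  toFun a e := a (G.tgt e) - a (G.src e)
  map_add' a b := by ext e; simp only [Pi.add_apply]; ring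
  map_smul' c a := by ext e; simp only [Pi.smul_apply, smul_eq_mul, RingHom.id_apply]; ring

open scoped BoundedContinuousFunction

variable {G}

theorem continuous_extend {p : G.EdgePoint → ℝ} (hp : Continuous p) (e : E) :
    Continuous (G.extend p e) :=
  hp.comp (continuous_sigmaMk.comp continuous_projIcc)

theorem extend_of_mem {p : G.EdgePoint → ℝ} {e : E} {t : ℝ} (ht : t ∈ Set.Icc 0 (G.len e)) :
    G.extend p e t = p ⟨e, t, ht⟩ := by
  rw [extend, Set.projIcc_of_mem _ ht]

variable (G) [Fintype E]

/-- The integrals of a square integrable function over the edges. -/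
noncomputable def increments : G.EdgeL2 →L[ℝ] (E → ℝ) :=
  ContinuousLinearMap.pi fun e => (primitiveL2 (G.len e) (G.len e)).comp (PiLp.proj 2 _ e)

/-- The derivatives of `H¹` functions on the graph. -/
noncomputable def gradients : Submodule ℝ G.EdgeL2 :=
  (LinearMap.range G.coboundary).comap G.increments.toLinearMap

/-- Integration over the edges as a functional on continuous functions. -/
noncomputable def edgeIntegralCLM : (G.EdgePoint →ᵇ ℝ) →L[ℝ] ℝ :=
  LinearMap.mkContinuous
    { toFun := fun p => G.edgeIntegral (G.extend p)
      map_add' := fun p r => edgeIntegral_add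
        (fun e => (continuous_extend p.continuous e).intervalIntegrable _ _)
        (fun e => (continuous_extend r.continuous e).intervalIntegrable _ _)
      map_smul' := fun c p => edgeIntegral_const_mul c _ } G.totalLength fun p => by
    simp only [LinearMap.coe_mk, AddHom.coe_mk, edgeIntegral, totalLength, Finset.sum_mul]
    refine (norm_sum_le _ _).trans (Finset.sum_le_sum fun e _ => ?_)
    have := intervalIntegral.norm_integral_le_of_norm_le_const (a := 0) (b := G.len e)
      (f := G.extend p e) (C := ‖p‖) fun x _ => p.norm_coe_le_norm _
    rwa [sub_zero, abs_of_pos (G.len_pos e), mul_comm] at this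

/-- The covariance of two continuous functions on the edges. -/
noncomputable def covariance : (G.EdgePoint →ᵇ ℝ) →L[ℝ] (G.EdgePoint →ᵇ ℝ) →L[ℝ] ℝ :=
  (ContinuousLinearMap.compL ℝ _ _ _ G.edgeIntegralCLM).comp
      (ContinuousLinearMap.mul ℝ (G.EdgePoint →ᵇ ℝ)) -
    G.totalLength⁻¹ • G.edgeIntegralCLM.smulRight G.edgeIntegralCLM

theorem covariance_apply (p r : G.EdgePoint →ᵇ ℝ) :
    G.covariance p r = G.edgeIntegral (fun e t => G.extend p e t * G.extend r e t) -
      G.edgeIntegral (G.extend p) * G.edgeIntegral (G.extend r) / G.totalLength := by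
  rw [covariance, div_eq_inv_mul]
  rfl

theorem covariance_comm (p r : G.EdgePoint →ᵇ ℝ) : G.covariance p r = G.covariance r p := by
  simp only [covariance_apply, mul_comm]

variable {G} in
/-- The covariance does not see additive constants. -/
theorem covariance_eq (hL : G.totalLength ≠ 0) {p r : G.EdgePoint →ᵇ ℝ} {f u : E → ℝ → ℝ}
    (hf : ∀ e, ContinuousOn (f e) (Set.Icc 0 (G.len e)))
    (hu : ∀ e, ContinuousOn (u e) (Set.Icc 0 (G.len e))) {c d : ℝ}
    (hp : ∀ e, ∀ t ∈ Set.Icc 0 (G.len e), G.extend p e t = f e t + c)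
    (hr : ∀ e, ∀ t ∈ Set.Icc 0 (G.len e), G.extend r e t = u e t + d) :
    G.covariance p r = G.edgeIntegral (fun e t => f e t * u e t) -
      G.edgeIntegral f * G.edgeIntegral u / G.totalLength := by
  rw [covariance_apply, edgeIntegral_congr (f' := fun e t => (f e t + c) * (u e t + d)),
    edgeIntegral_congr hp, edgeIntegral_congr hr, edgeIntegral_add_const hf,
    edgeIntegral_add_const hu, edgeIntegral_add_const_mul_add_const hf hu]
  · field_simp; ring
  · intro e t ht
    rw [hp e t ht, hr e t ht]

variable {G} in
-- A surjective linear map of vector spaces splits. The splitting fixes the additive constant in the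
-- primitive of a gradient in a linear way.
theorem exists_potential : ∃ S : LinearMap.range G.coboundary →ₗ[ℝ] (V → ℝ),
    ∀ x, G.coboundary (S x) = x := by
  obtain ⟨S, hS⟩ := G.coboundary.rangeRestrict.exists_rightInverse_of_surjective
    (LinearMap.range_rangeRestrict _)
  exact ⟨S, fun x => congrArg Subtype.val (LinearMap.congr_fun hS x)⟩

/-- A potential of the coboundaries. -/
noncomputable def potential : LinearMap.range G.coboundary →ₗ[ℝ] (V → ℝ) :=
  exists_potential.choose

theorem coboundary_potential (x : LinearMap.range G.coboundary) :
    G.coboundary (G.potential x) = x := exists_potential.choose_spec x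

/-- The vertex values of an `H¹` function with given derivative. -/
noncomputable def vertexValues : G.gradients →ₗ[ℝ] (V → ℝ) :=
  G.potential.comp ((G.increments.toLinearMap.domRestrict G.gradients).codRestrict _ fun z => z.2)

theorem vertexValues_tgt_sub_src (z : G.gradients) (e : E) :
    G.vertexValues z (G.tgt e) - G.vertexValues z (G.src e) =
      primitiveL2 (G.len e) (G.len e) (z.1 e) :=
  congrFun (G.coboundary_potential _) e

/-- An `H¹` function with given derivative. -/
noncomputable def integrate : G.gradients →ₗ[ℝ] (G.EdgePoint →ᵇ ℝ) where
  toFun z := BoundedContinuousFunction.mkOfCompact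
    ⟨fun k => G.vertexValues z (G.src k.1) + primitiveL2 (G.len k.1) k.2 (z.1 k.1),
      by
      refine continuous_sigma fun e => ?_
      exact (continuous_primitiveL2 (z.1 e)).const_add (G.vertexValues z (G.src e))⟩
  map_add' y z := by
    ext k
    simp only [map_add, Pi.add_apply, Submodule.coe_add, PiLp.add_apply,
      BoundedContinuousFunction.mkOfCompact_apply, ContinuousMap.coe_mk,
      BoundedContinuousFunction.coe_add]
    ring
  map_smul' c z := by
    ext k
    simp only [map_smul, Pi.smul_apply, Submodule.coe_smul, PiLp.smul_apply, smul_eq_mul,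
      BoundedContinuousFunction.mkOfCompact_apply, ContinuousMap.coe_mk,
      BoundedContinuousFunction.coe_smul, RingHom.id_apply]
    ring

theorem integrate_apply (z : G.gradients) (k : G.EdgePoint) :
    G.integrate z k = G.vertexValues z (G.src k.1) + primitiveL2 (G.len k.1) k.2 (z.1 k.1) := rfl

/-- Being a gradient only restricts the vector of increments to a finite-dimensional, hence closed,
subspace. This gives the completeness that the direct method needs. -/
theorem isClosed_gradients : IsClosed (G.gradients : Set G.EdgeL2) :=
  (Submodule.closed_of_finiteDimensional (LinearMap.range G.coboundary)).preimage
    G.increments.continuous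

instance : CompleteSpace G.gradients := G.isClosed_gradients.completeSpace_coe

/-- The `H¹` functions with derivative of norm at most one form a relatively compact set of
continuous functions, up to additive constants. -/
theorem isCompact_closure_integrate [Fintype V] :
    IsCompact (closure (G.integrate '' Metric.closedBall 0 1)) := by
  have hz : ∀ z ∈ Metric.closedBall (0 : G.gradients) 1, ∀ e, ‖z.1 e‖ ≤ 1 := fun z hz e =>
    (PiLp.norm_apply_le z.1 e).trans (by simpa using hz)
  have hprim : ∀ z ∈ Metric.closedBall (0 : G.gradients) 1, ∀ e, ∀ s ∈ Set.Icc 0 (G.len e),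
      ∀ t ∈ Set.Icc 0 (G.len e), |primitiveL2 (G.len e) s (z.1 e) - primitiveL2 (G.len e) t (z.1 e)|
        ≤ √|s - t| := fun z hzb e s hs t ht =>
    (abs_primitiveL2_sub_le hs ht _).trans
      (mul_le_of_le_one_right (Real.sqrt_nonneg _) (hz z hzb e))
  have hprim' : ∀ z ∈ Metric.closedBall (0 : G.gradients) 1, ∀ e, ∀ s ∈ Set.Icc 0 (G.len e),
      |primitiveL2 (G.len e) s (z.1 e)| ≤ √G.totalLength := fun z hzb e s hs => by
    have h0 : (0 : ℝ) ∈ Set.Icc 0 (G.len e) := ⟨le_rfl, (G.len_pos e).le⟩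
    have h1 := hprim z hzb e s hs 0 h0
    have h2 : primitiveL2 (G.len e) 0 (z.1 e) = 0 := by simp [primitiveL2_apply h0]
    rw [h2, sub_zero, sub_zero, abs_of_nonneg hs.1] at h1
    refine h1.trans (Real.sqrt_le_sqrt (hs.2.trans ?_))
    exact Finset.single_le_sum (f := G.len) (fun e _ => (G.len_pos e).le) (Finset.mem_univ e)
  -- The vertex values depend linearly on finitely many increments, so they are bounded uniformly on
  -- the unit ball.
  obtain ⟨C, hC0, hC⟩ := G.potential.toContinuousLinearMap.bound
  set R := C * √G.totalLength + √G.totalLength with hR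
  refine BoundedContinuousFunction.arzela_ascoli (Set.Icc (-R) R) isCompact_Icc _ ?_ ?_
  · rintro _ k ⟨z, hzb, rfl⟩
    rw [Set.mem_Icc, ← abs_le, integrate_apply]
    refine (abs_add_le _ _).trans (add_le_add ?_ (hprim' z hzb _ _ k.2.2))
    refine (norm_le_pi_norm (G.vertexValues z) (G.src k.1)).trans ((hC _).trans ?_)
    gcongr
    refine (pi_norm_le_iff_of_nonneg (Real.sqrt_nonneg _)).2 fun e => ?_
    exact hprim' z hzb e _ ⟨(G.len_pos e).le, le_rfl⟩
  -- Points near `⟨e, s⟩` lie on the same edge, so the vertex value cancels in the difference and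
  -- only the Hölder bound remains.
  · rintro ⟨e, s⟩
    rw [Metric.equicontinuousAt_iff_right]
    intro ε hε
    rw [Sigma.nhds_mk, Filter.eventually_map]
    have hcont : Continuous fun t : Set.Icc 0 (G.len e) => √|(s : ℝ) - t| := by fun_prop
    have := (hcont.tendsto s).eventually (gt_mem_nhds (show √|(s : ℝ) - s| < ε by simpa using hε))
    filter_upwards [this] with t ht
    rintro ⟨_, z, hzb, rfl⟩
    refine lt_of_le_of_lt ?_ ht
    simp only [integrate_apply, dist_add_left, Real.dist_eq]
    exact hprim z hzb e _ s.2 _ t.2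

end MetricGraph

/-! ### Existence of an extremal function -/

theorem ContinuousOn.memLp_restrict_Icc {F : Type*} [NormedAddCommGroup F]
    [SecondCountableTopologyEither ℝ F] {l : ℝ} {f : ℝ → F} (hf : ContinuousOn f (Set.Icc 0 l)) :
    MemLp f 2 (volume.restrict (Set.Icc 0 l)) := by
  obtain ⟨C, hC⟩ := isCompact_Icc.exists_bound_of_continuousOn hf
  exact MemLp.of_bound (hf.aestronglyMeasurable measurableSet_Icc) C
    ((ae_restrict_iff' measurableSet_Icc).2 (Filter.Eventually.of_forall hC))

theorem intervalIntegral_congr_restrict_Icc {F : Type*} [NormedAddCommGroup F] [NormedSpace ℝ F]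
    {l x : ℝ} {f g : ℝ → F} (h : f =ᵐ[volume.restrict (Set.Icc 0 l)] g) (hx : x ∈ Set.Icc 0 l) :
    ∫ t in (0 : ℝ)..x, f t = ∫ t in (0 : ℝ)..x, g t := by
  rw [intervalIntegral.integral_of_le hx.1, intervalIntegral.integral_of_le hx.1]
  refine integral_congr_ae (ae_restrict_of_ae_restrict_of_subset ?_ h)
  exact fun t ht => ⟨ht.1.le, ht.2.trans hx.2⟩

namespace MetricGraph

variable {V E : Type*} {G : MetricGraph V E}

theorem left_mem (e : E) : (0 : ℝ) ∈ Set.Icc 0 (G.len e) := ⟨le_rfl, (G.len_pos e).le⟩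

theorem right_mem (e : E) : G.len e ∈ Set.Icc 0 (G.len e) := ⟨(G.len_pos e).le, le_rfl⟩

variable [Fintype E]

theorem edgeIntegral_congr_ae {f f' : E → ℝ → ℝ}
    (h : ∀ e, f e =ᵐ[volume.restrict (Set.Icc 0 (G.len e))] f' e) :
    G.edgeIntegral f = G.edgeIntegral f' :=
  Finset.sum_congr rfl fun e _ => intervalIntegral_congr_restrict_Icc (h e) (right_mem e)

theorem totalLength_pos [Nonempty E] : 0 < G.totalLength :=
  Finset.sum_pos (fun e _ => G.len_pos e) Finset.univ_nonempty

/-- The vertex values of two functions with the same derivative differ by a function that agrees at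
the ends of every edge, hence by a constant on a connected graph. So the form may be evaluated on
any primitive, provided it ignores constants. -/
theorem IsConnected.exists_gradient [Fintype V] (hG : G.IsConnected) {b : V → ℝ} {u w : E → ℝ → ℝ}
    (h : G.IsH1 b u w) : ∃ z : G.gradients,
      (∀ e, z.1 e =ᵐ[volume.restrict (Set.Icc 0 (G.len e))] w e) ∧
      ∃ d, ∀ e, ∀ t ∈ Set.Icc 0 (G.len e), G.extend (G.integrate z) e t = u e t + d := by
  set z : G.EdgeL2 := WithLp.toLp 2 fun e => (h.memLp e).toLp with hz
  have hzw : ∀ e, z e =ᵐ[volume.restrict (Set.Icc 0 (G.len e))] w e := fun e =>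
    (h.memLp e).coeFn_toLp
  have hprim : ∀ e, ∀ t ∈ Set.Icc 0 (G.len e), primitiveL2 (G.len e) t (z e) =
      ∫ s in (0 : ℝ)..t, w e s := fun e t ht => by
    rw [primitiveL2_apply ht, intervalIntegral_congr_restrict_Icc (hzw e) ht]
  have hmem : z ∈ G.gradients := by
    refine ⟨b, funext fun e => ?_⟩
    change b (G.tgt e) - b (G.src e) = primitiveL2 (G.len e) (G.len e) (z e)
    rw [hprim e _ (right_mem e), ← h.tgt, ← h.src, h.integral e _ (right_mem e)]
    ring
  refine ⟨⟨z, hmem⟩, hzw, ?_⟩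
  rcases isEmpty_or_nonempty V with hV | ⟨⟨v₀⟩⟩
  · exact ⟨0, fun e => (hV.false (G.src e)).elim⟩
  set y : G.gradients := ⟨z, hmem⟩
  have hconst := hG.eq_of_src_eq_tgt (a := fun v => G.vertexValues y v - b v) fun e => by
    have h1 := G.vertexValues_tgt_sub_src y e
    rw [hprim e _ (right_mem e)] at h1
    have h2 := h.integral e _ (right_mem e)
    rw [h.tgt, h.src] at h2
    linarith
  refine ⟨G.vertexValues y v₀ - b v₀, fun e t ht => ?_⟩
  rw [extend_of_mem ht, integrate_apply, ← hconst (G.src e) v₀, hprim e t ht, h.integral e t ht,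
    h.src]
  ring

theorem isH1_integrate (z : G.gradients) :
    G.IsH1 (G.vertexValues z) (G.extend (G.integrate z)) fun e => z.1 e := by
  have h0 : ∀ e, G.extend (G.integrate z) e 0 = G.vertexValues z (G.src e) := fun e => by
    rw [extend_of_mem (left_mem e), integrate_apply, primitiveL2_apply (left_mem e)]
    simp
  refine ⟨fun e => Lp.memLp _, h0, fun e => ?_, fun e t ht => ?_⟩
  · rw [extend_of_mem (right_mem e), integrate_apply, ← vertexValues_tgt_sub_src]
    ring
  · rw [h0, extend_of_mem ht, integrate_apply, primitiveL2_apply ht]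

theorem inner_gradients (y z : G.gradients) :
    inner ℝ y z = G.edgeIntegral fun e t => y.1 e t * z.1 e t := by
  rw [Submodule.coe_inner, PiLp.inner_apply, edgeIntegral]
  refine Finset.sum_congr rfl fun e _ => ?_
  rw [L2.inner_def, intervalIntegral.integral_of_le (G.len_pos e).le,
    ← integral_Icc_eq_integral_Ioc]
  simp [mul_comm]

/-- On a connected graph, the quotient of the variance and the energy attains its maximum over the
`H¹` functions, and a maximizer satisfies the weak form of the eigenvalue equation. -/
theorem IsConnected.exists_extremal [Fintype V] (hG : G.IsConnected) {a₀ : V → ℝ}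
    {f₀ g₀ : E → ℝ → ℝ} (h₀ : G.IsH1 a₀ f₀ g₀) (hv : 0 < G.variance f₀) :
    ∃ κ > 0, (∀ b u w, G.IsH1 b u w →
        G.variance u ≤ κ * G.edgeIntegral fun e t => w e t * w e t) ∧
      ∃ a f g, G.IsH1 a f g ∧ 0 < G.edgeIntegral (fun e t => f e t * f e t) ∧
        ∀ b u w, G.IsH1 b u w → G.edgeIntegral (fun e t => f e t * u e t) =
          κ * G.edgeIntegral fun e t => g e t * w e t := by
  -- Without edges the variance would be zero.
  have hE : Nonempty E := by
    by_contra h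
    rw [not_nonempty_iff] at h
    simp [variance, edgeIntegral] at hv
  have hL := (G.totalLength_pos).ne'
  obtain ⟨z₀, -, d₀, hd₀⟩ := hG.exists_gradient h₀
  have hcov : ∀ {b u w} (_ : G.IsH1 b u w) {z : G.gradients} {d : ℝ}
      (_ : ∀ e, ∀ t ∈ Set.Icc 0 (G.len e), G.extend (G.integrate z) e t = u e t + d),
      G.covariance (G.integrate z) (G.integrate z) = G.variance u := fun h _ _ hd =>
    covariance_eq hL h.continuousOn h.continuousOn hd hd
  obtain ⟨κ, hκ, y, hy, hmax, hEL⟩ := exists_maximizer_of_compact G.integrate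
    G.isCompact_closure_integrate (fun z hz => subset_closure ⟨z, by simpa using hz, rfl⟩)
    G.covariance G.covariance_comm (y₀ := z₀) (by rwa [hcov h₀ hd₀])
  refine ⟨κ, hκ, fun b u w h => ?_, ?_⟩
  · obtain ⟨z, hz, d, hd⟩ := hG.exists_gradient h
    have := hmax z
    rw [hcov h hd, ← real_inner_self_eq_norm_sq, inner_gradients] at this
    rwa [edgeIntegral_congr_ae (f' := fun e t => w e t * w e t) fun e => by
      filter_upwards [hz e] with t ht; rw [ht]] at this
  · have hy1 := isH1_integrate y
    -- Once the maximizer has mean zero, its covariance with any function is the plain L² pairing,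
    -- as the weak equation requires.
    set m := G.edgeIntegral (G.extend (G.integrate y)) / G.totalLength with hm
    have hf := hy1.add_const (-m)
    have hmean : G.edgeIntegral (fun e t => G.extend (G.integrate y) e t + -m) = 0 := by
      rw [edgeIntegral_add_const hy1.continuousOn, hm]
      field_simp; ring
    have hcov' : ∀ {b u w} (_ : G.IsH1 b u w) {z : G.gradients} {d : ℝ}
        (_ : ∀ e, ∀ t ∈ Set.Icc 0 (G.len e), G.extend (G.integrate z) e t = u e t + d),
        G.covariance (G.integrate y) (G.integrate z) =
          G.edgeIntegral fun e t => (G.extend (G.integrate y) e t + -m) * u e t :=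
      fun h _ _ hd => by
        rw [covariance_eq hL hf.continuousOn h.continuousOn (c := m) (by intros; ring) hd, hmean]
        simp
    refine ⟨_, _, _, hf, ?_, fun b u w h => ?_⟩
    · rwa [← hcov' hf (z := y) (d := m) (by intros; ring)]
    · obtain ⟨z, hz, d, hd⟩ := hG.exists_gradient h
      rw [← hcov' h hd, hEL, inner_gradients,
        edgeIntegral_congr_ae (f' := fun e t => y.1 e t * w e t) fun e => by
          filter_upwards [hz e] with t ht; rw [ht]]

open Classical in
/-- The Kirchhoff conditions say that the boundary terms from integrating by parts vanish. -/
theorem kirchhoff_iff [Fintype V] {p r : E → ℝ} :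
    (∀ v : V, (∑ e : E, if G.src e = v then p e else 0) +
      (∑ e : E, if G.tgt e = v then -r e else 0) = 0) ↔
    ∀ a : V → ℝ, ∑ e, (a (G.tgt e) * r e - a (G.src e) * p e) = 0 := by
  have key : ∀ a : V → ℝ, ∑ e, (a (G.tgt e) * r e - a (G.src e) * p e) = -∑ v, a v *
      ((∑ e : E, if G.src e = v then p e else 0) + ∑ e : E, if G.tgt e = v then -r e else 0) := by
    intro a
    simp only [mul_add, Finset.mul_sum, Finset.sum_add_distrib, mul_ite, mul_zero]
    rw [Finset.sum_comm, Finset.sum_comm (s := (Finset.univ : Finset V))]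
    simp [sub_eq_add_neg, Finset.sum_add_distrib]
  constructor
  · intro h a
    rw [key]
    simp [h]
  · intro h v
    have := h (Pi.single v 1)
    rw [key, neg_eq_zero, Finset.sum_eq_single v] at this
    · simpa using this
    · intro w _ hw
      simp [hw]
    · simp

end MetricGraph

/-! ### Weak solutions, eigenfunctions and the spectral gap -/

namespace MetricGraph

variable {V E : Type*} {G : MetricGraph V E}

theorem pt_zero (e : E) : G.pt e 0 = G.vertex (G.src e) := by
  rw [pt, Set.projIcc_of_mem _ (left_mem e)]
  exact Quot.sound (.src e)

theorem pt_len (e : E) : G.pt e (G.len e) = G.vertex (G.tgt e) := by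
  rw [pt, Set.projIcc_of_mem _ (right_mem e)]
  exact Quot.sound (.tgt e)

theorem isH1_const (c : ℝ) : G.IsH1 (fun _ => c) (fun _ _ => c) (fun _ _ => 0) :=
  ⟨fun _ => memLp_const 0, fun _ => rfl, fun _ => rfl, fun _ _ _ => by simp⟩

variable [Fintype E]

/-- A weak solution of `κ f'' = -f` on an edge, tested against functions that vanish at the
vertices, has a derivative that is a primitive of `-f / κ`. -/
theorem exists_deriv_eq_of_weak {κ : ℝ} (hκ : 0 < κ) {a : V → ℝ} {f g : E → ℝ → ℝ}
    (h : G.IsH1 a f g)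
    (hw : ∀ b u w, G.IsH1 b u w → G.edgeIntegral (fun e t => f e t * u e t) =
      κ * G.edgeIntegral fun e t => g e t * w e t) (e : E) :
    ∃ c : ℝ, g e =ᵐ[volume.restrict (Set.Icc 0 (G.len e))]
      fun x => c + ∫ t in (0 : ℝ)..x, -f e t / κ := by
  classical
  set l := G.len e with hl
  have hl0 : 0 < l := G.len_pos e
  set P : ℝ → ℝ := fun x => ∫ t in (0 : ℝ)..x, f e t with hP
  have hfi := h.intervalIntegrable e
  have hPc : ContinuousOn P (Set.Icc 0 l) := by
    have h0 : IntegrableOn (f e) (Set.uIcc 0 l) := by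
      rw [Set.uIcc_of_le hl0.le]
      exact (h.continuousOn e).integrableOn_Icc
    simpa [Set.uIcc_of_le hl0.le] using intervalIntegral.continuousOn_primitive_interval h0
  have hr : MemLp (fun t => κ * g e t + P t) 2 (volume.restrict (Set.Icc 0 l)) :=
    ((h.memLp e).const_mul κ).add hPc.memLp_restrict_Icc
  set m := (∫ t in (0 : ℝ)..l, (κ * g e t + P t)) / l with hm
  -- The argument of du Bois-Reymond: subtracting the mean m makes the primitive of ψ vanish at both
  -- ends of the edge, hence an admissible test function, and testing with it gives ∫ ψ² = 0.
  set ψ : ℝ → ℝ := fun t => κ * g e t + P t - m with hψ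
  have hψL : MemLp ψ 2 (volume.restrict (Set.Icc 0 l)) := hr.sub (memLp_const m)
  have hψi : IntervalIntegrable ψ volume 0 l :=
    hψL.intervalIntegrable_of_restrict_Icc (left_mem e) (right_mem e)
  have hψ0 : ∫ t in (0 : ℝ)..l, ψ t = 0 := by
    rw [hψ, intervalIntegral.integral_sub
      (hr.intervalIntegrable_of_restrict_Icc (left_mem e) (right_mem e)) intervalIntegrable_const,
      intervalIntegral.integral_const, hm]
    simp only [sub_zero, smul_eq_mul]
    field_simp; ring
  have hH1 : G.IsH1 (fun _ => 0) (fun e' x => if e' = e then ∫ t in (0 : ℝ)..x, ψ t else 0)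
      (fun e' => if e' = e then ψ else 0) := by
    refine ⟨fun e' => ?_, fun e' => ?_, fun e' => ?_, fun e' x _ => ?_⟩
    · by_cases he : e' = e
      · subst he; simpa using hψL
      · simp [he]
    · simp
    · by_cases he : e' = e
      · subst he; simpa using hψ0
      · simp [he]
    · by_cases he : e' = e <;> simp [he]
  have key := hw _ _ _ hH1
  have e1 : G.edgeIntegral (fun e' t => f e' t * if e' = e then ∫ t in (0 : ℝ)..t, ψ t else 0) =
      ∫ t in (0 : ℝ)..l, f e t * ∫ t in (0 : ℝ)..t, ψ t := by
    rw [edgeIntegral, Finset.sum_eq_single e]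
    · simp [hl]
    · intro e' _ he; simp [he]
    · simp
  have e2 : G.edgeIntegral (fun e' t => g e' t * (if e' = e then ψ else 0) t) =
      ∫ t in (0 : ℝ)..l, g e t * ψ t := by
    rw [edgeIntegral, Finset.sum_eq_single e]
    · simp [hl]
    · intro e' _ he; simp [he]
    · simp
  rw [e1, e2] at key
  -- By parts, and then by the weak equation, ∫ P ψ = -∫ f ∫ψ = -κ ∫ g ψ.
  have ibp := integral_mul_of_eq_integral hl0.le (A := P) (B := fun x => ∫ t in (0 : ℝ)..x, ψ t)
    hfi hψi (by simp [hP]) (by simp)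
  rw [hψ0] at ibp
  simp only [intervalIntegral.integral_same, mul_zero, sub_zero, zero_sub] at ibp
  rw [key] at ibp
  have hgψ : IntervalIntegrable (fun t => g e t * ψ t) volume 0 l := by
    have : IntegrableOn (fun t => g e t * ψ t) (Set.Icc 0 l) := (h.memLp e).integrable_mul hψL
    exact (this.mono_set (by rw [Set.uIcc_of_le hl0.le])).intervalIntegrable
  have hPψ : IntervalIntegrable (fun t => P t * ψ t) volume 0 l := by
    have : IntegrableOn (fun t => P t * ψ t) (Set.Icc 0 l) :=
      hPc.memLp_restrict_Icc.integrable_mul hψL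
    exact (this.mono_set (by rw [Set.uIcc_of_le hl0.le])).intervalIntegrable
  have hsq : ∫ t in (0 : ℝ)..l, ψ t ^ 2 = 0 := by
    have : (fun t => ψ t ^ 2) = fun t => κ * (g e t * ψ t) + P t * ψ t - m * ψ t := by
      ext t; simp only [hψ]; ring
    rw [this, intervalIntegral.integral_sub ((hgψ.const_mul κ).add hPψ) (hψi.const_mul m),
      intervalIntegral.integral_add (hgψ.const_mul κ) hPψ, ibp]
    simp [hψ0]
  have hψae : ψ =ᵐ[volume.restrict (Set.Icc 0 l)] 0 := by
    have h2 : ∫ t in Set.Icc 0 l, ψ t ^ 2 = 0 := by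
      rw [integral_Icc_eq_integral_Ioc, ← intervalIntegral.integral_of_le hl0.le, hsq]
    have h3 := (integral_eq_zero_iff_of_nonneg (fun t => sq_nonneg (ψ t)) hψL.integrable_sq).1 h2
    filter_upwards [h3] with t ht
    simpa using ht
  refine ⟨m / κ, ?_⟩
  filter_upwards [hψae] with t ht
  have : κ * g e t + P t - m = 0 := ht
  rw [intervalIntegral.integral_div, intervalIntegral.integral_neg]
  change g e t = m / κ + -P t / κ
  field_simp
  linarith

/-- Integration by parts on the whole graph, for a function `r` on the edges with derivative `k`
that satisfies the Kirchhoff conditions. -/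
theorem edgeIntegral_mul_deriv {b : V → ℝ} {u w r k : E → ℝ → ℝ} (h : G.IsH1 b u w)
    (hk : ∀ e, IntervalIntegrable (k e) volume 0 (G.len e))
    (hr : ∀ e, ∀ x ∈ Set.Icc 0 (G.len e), r e x = r e 0 + ∫ t in (0 : ℝ)..x, k e t) :
    G.edgeIntegral (fun e t => u e t * k e t) =
      ∑ e, (b (G.tgt e) * r e (G.len e) - b (G.src e) * r e 0) -
        G.edgeIntegral fun e t => w e t * r e t := by
  rw [edgeIntegral, edgeIntegral, ← Finset.sum_sub_distrib]
  refine Finset.sum_congr rfl fun e _ => ?_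
  rw [integral_mul_of_eq_integral (G.len_pos e).le (h.intervalIntegrable_deriv e) (hk e)
    (h.integral e) (hr e), h.tgt, h.src]

/-- A weak solution of the eigenvalue equation is an eigenfunction. -/
theorem isEigenvalue_of_weak [Fintype V] {κ : ℝ} (hκ : 0 < κ) {a : V → ℝ} {f g : E → ℝ → ℝ}
    (h : G.IsH1 a f g) (hf : 0 < G.edgeIntegral fun e t => f e t * f e t)
    (hw : ∀ b u w, G.IsH1 b u w → G.edgeIntegral (fun e t => f e t * u e t) =
      κ * G.edgeIntegral fun e t => g e t * w e t) :
    G.IsEigenvalue κ⁻¹ := by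
  choose c hc using exists_deriv_eq_of_weak hκ h hw
  set r : E → ℝ → ℝ := fun e x => c e + ∫ t in (0 : ℝ)..x, -f e t / κ with hr
  have hki : ∀ e, IntervalIntegrable (fun t => -f e t / κ) volume 0 (G.len e) := fun e =>
    (h.intervalIntegrable e).neg.div_const κ
  have hr0 : ∀ e, ∀ x ∈ Set.Icc 0 (G.len e), r e x = r e 0 + ∫ t in (0 : ℝ)..x, -f e t / κ :=
    fun e x _ => by simp [hr]
  let F : G.Point → ℂ := Quot.lift (Sum.elim (fun v => (a v : ℂ)) fun p => (f p.1 p.2 : ℂ)) (by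
    rintro _ _ (e | e)
    · exact congrArg Complex.ofReal (h.src e)
    · exact congrArg Complex.ofReal (h.tgt e))
  have hF : ∀ e, ∀ x ∈ Set.Icc 0 (G.len e), F (G.pt e x) = f e x := fun e x hx => by
    rw [pt, Set.projIcc_of_mem _ hx]; rfl
  refine ⟨F, ?_, fun e t => (r e t : ℂ), fun e t => ((-f e t / κ : ℝ) : ℂ), fun e => ⟨?_, ?_, ?_⟩,
    ?_, fun e => ?_⟩
  · by_contra! hcon
    refine hf.ne' ?_
    rw [edgeIntegral_congr (f' := fun _ _ => 0), edgeIntegral_const, zero_mul]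
    intro e x hx
    have h1 := hcon e x hx
    rw [hF e x hx, Complex.ofReal_eq_zero] at h1
    rw [h1, mul_zero]
  · refine ContinuousOn.memLp_restrict_Icc ?_
    exact Complex.continuous_ofReal.comp_continuousOn ((h.continuousOn e).neg.div_const κ)
  · intro x hx
    simp only [hF e x hx, hF e 0 (left_mem e)]
    rw [intervalIntegral.integral_ofReal, h.integral e x hx,
      intervalIntegral_congr_restrict_Icc (hc e) hx]
    push_cast; rfl
  · intro x hx
    rw [intervalIntegral.integral_ofReal, ← Complex.ofReal_add]
    exact congrArg Complex.ofReal (hr0 e x hx)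
  -- The Kirchhoff conditions are natural boundary conditions: testing with the edgewise affine
  -- function of arbitrary vertex values b leaves only the boundary terms.
  · have hK : ∀ b : V → ℝ,
        ∑ e, (b (G.tgt e) * r e (G.len e) - b (G.src e) * r e 0) = 0 := fun b => by
      have hlin : G.IsH1 b
          (fun e x => b (G.src e) + x * ((b (G.tgt e) - b (G.src e)) / G.len e))
          (fun e _ => (b (G.tgt e) - b (G.src e)) / G.len e) := by
        refine ⟨fun e => memLp_const _, fun e => by simp, fun e => ?_, fun e x _ => by
          rw [intervalIntegral.integral_const, smul_eq_mul]; ring⟩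
        have := (G.len_pos e).ne'
        field_simp; ring
      have h1 := edgeIntegral_mul_deriv hlin hki hr0
      have h2 := hw _ _ _ hlin
      have h3 : G.edgeIntegral (fun e t => (b (G.src e) + t * ((b (G.tgt e) - b (G.src e)) /
          G.len e)) * (-f e t / κ)) = -κ⁻¹ * G.edgeIntegral fun e t => f e t *
            (b (G.src e) + t * ((b (G.tgt e) - b (G.src e)) / G.len e)) := by
        rw [← edgeIntegral_const_mul]
        congr 1; ext e t; rw [div_eq_mul_inv]; ring
      have h4 : G.edgeIntegral (fun e t => (b (G.tgt e) - b (G.src e)) / G.len e * r e t) =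
          G.edgeIntegral fun e t => g e t * ((b (G.tgt e) - b (G.src e)) / G.len e) :=
        edgeIntegral_congr_ae fun e => by
          filter_upwards [hc e] with t ht
          rw [ht, mul_comm]
      rw [h3, h2, h4, ← mul_assoc, neg_mul, inv_mul_cancel₀ hκ.ne'] at h1
      linarith
    intro v
    have := congrArg Complex.ofReal (kirchhoff_iff.2 hK v)
    simpa only [Complex.ofReal_add, Complex.ofReal_sum, apply_ite Complex.ofReal,
      Complex.ofReal_neg, Complex.ofReal_zero] using this
  · refine (ae_restrict_iff' measurableSet_Icc).2 (Filter.Eventually.of_forall fun x hx => ?_)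
    simp only [hF e x hx]
    push_cast
    ring

/-- The part `T` of an eigenfunction (`T` being the real or the imaginary part) satisfies the weak
eigenvalue equation. -/
theorem IsHamiltonian.exists_weak [Fintype V] {f : G.Point → ℂ} {μ : ℝ}
    (h : G.IsHamiltonian f fun e s => (μ : ℂ) * f (G.pt e s)) (T : ℂ →L[ℝ] ℝ) :
    ∃ g : E → ℝ → ℝ, G.IsH1 (fun v => T (f (G.vertex v))) (fun e t => T (f (G.pt e t))) g ∧
      ∀ b u w, G.IsH1 b u w → μ * G.edgeIntegral (fun e t => u e t * T (f (G.pt e t))) =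
        G.edgeIntegral fun e t => w e t * g e t := by
  obtain ⟨f', f'', hd, hK, hμ⟩ := h
  have hii : ∀ e, ∀ x ∈ Set.Icc 0 (G.len e), IntervalIntegrable (f'' e) volume 0 x := fun e x hx =>
    (hd e).memLp.intervalIntegrable_of_restrict_Icc (left_mem e) hx
  have hf'c : ∀ e, ContinuousOn (f' e) (Set.Icc 0 (G.len e)) := fun e => by
    have h0 : IntegrableOn (f'' e) (Set.uIcc 0 (G.len e)) := by
      rw [Set.uIcc_of_le (G.len_pos e).le]
      exact (hd e).memLp.integrable (by norm_num)
    have := (intervalIntegral.continuousOn_primitive_interval h0).const_add (f' e 0)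
    rw [Set.uIcc_of_le (G.len_pos e).le] at this
    exact this.congr (hd e).second
  have hi : ∀ e, ∀ x ∈ Set.Icc 0 (G.len e), IntervalIntegrable (f' e) volume 0 x := fun e x hx =>
    ContinuousOn.intervalIntegrable_of_Icc hx.1 ((hf'c e).mono (Set.Icc_subset_Icc_right hx.2))
  have hH1 : G.IsH1 (fun v => T (f (G.vertex v))) (fun e t => T (f (G.pt e t)))
      (fun e t => T (f' e t)) := by
    refine ⟨fun e => ?_, fun e => by rw [pt_zero], fun e => by rw [pt_len], fun e x hx => ?_⟩
    · exact (T.continuous.comp_continuousOn (hf'c e)).memLp_restrict_Icc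
    · rw [T.intervalIntegral_comp_comm (hi e x hx), ← map_add]
      exact congrArg T ((hd e).first x hx)
  have hr : ∀ e, ∀ x ∈ Set.Icc 0 (G.len e),
      T (f' e x) = T (f' e 0) + ∫ t in (0 : ℝ)..x, -μ * T (f (G.pt e t)) := fun e x hx => by
    rw [(hd e).second x hx, map_add, ← T.intervalIntegral_comp_comm (hii e x hx)]
    congr 1
    refine intervalIntegral_congr_restrict_Icc ?_ hx
    filter_upwards [hμ e] with t ht
    have : f'' e t = (-μ : ℝ) • f (G.pt e t) := by
      rw [Complex.real_smul, ← neg_neg (f'' e t), ht]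
      push_cast; ring
    rw [this, map_smul, smul_eq_mul]
  refine ⟨_, hH1, fun b u w hu => ?_⟩
  have hkir := kirchhoff_iff (G := G) (p := fun e => T (f' e 0)) (r := fun e => T (f' e (G.len e)))
  have hzero := hkir.1 (fun v => by
    have := congrArg T (hK v)
    simp only [map_add, map_sum, map_zero] at this
    refine Eq.trans (congrArg₂ _ (Finset.sum_congr rfl fun e _ => ?_)
      (Finset.sum_congr rfl fun e _ => ?_)) this <;> split_ifs <;> simp) b
  have := edgeIntegral_mul_deriv hu (fun e => (hH1.intervalIntegrable e).const_mul (-μ)) hr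
  rw [hzero, zero_sub] at this
  have e1 : (fun e t => u e t * (-μ * T (f (G.pt e t)))) =
      fun e t => -μ * (u e t * T (f (G.pt e t))) := by ext e t; ring
  rw [e1, edgeIntegral_const_mul] at this
  linarith

theorem edgeIntegral_mul_self_pos {f : E → ℝ → ℝ}
    (hf : ∀ e, ContinuousOn (f e) (Set.Icc 0 (G.len e))) {e₀ : E} {x₀ : ℝ}
    (hx₀ : x₀ ∈ Set.Icc 0 (G.len e₀)) (h0 : f e₀ x₀ ≠ 0) :
    0 < G.edgeIntegral fun e t => f e t * f e t :=
  Finset.sum_pos' (fun e _ => intervalIntegral.integral_nonneg (G.len_pos e).le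
    fun _ _ => mul_self_nonneg _) ⟨e₀, Finset.mem_univ _,
      intervalIntegral.integral_pos (G.len_pos e₀) ((hf e₀).mul (hf e₀))
        (fun _ _ => mul_self_nonneg _) ⟨x₀, hx₀, mul_self_pos.2 h0⟩⟩

/-- If some `H¹` function is not constant, then there is a spectral gap, and it is the best constant
in the Poincaré inequality. -/
theorem IsConnected.exists_isSpectralGap [Fintype V] (hG : G.IsConnected) {a₀ : V → ℝ}
    {f₀ g₀ : E → ℝ → ℝ} (h₀ : G.IsH1 a₀ f₀ g₀) (hv : 0 < G.variance f₀) :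
    ∃ lam > 0, G.IsSpectralGap lam ∧ ∀ b u w, G.IsH1 b u w →
      lam * G.variance u ≤ G.edgeIntegral fun e t => w e t * w e t := by
  obtain ⟨κ, hκ, hP, a, f, g, hf, hff, hw⟩ := hG.exists_extremal h₀ hv
  refine ⟨κ⁻¹, inv_pos.2 hκ, ⟨⟨(inv_pos.2 hκ).ne', isEigenvalue_of_weak hκ hf hff hw⟩, ?_⟩,
    fun b u w h => (inv_mul_le_iff₀ hκ).2 (hP b u w h)⟩
  rintro μ ⟨hμ0, F, ⟨e₀, x₀, hx₀, hne⟩, hF⟩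
  -- The real or the imaginary part of the eigenfunction is nonzero at the given point.
  obtain ⟨T, hT⟩ : ∃ T : ℂ →L[ℝ] ℝ, T (F (G.pt e₀ x₀)) ≠ 0 := by
    by_contra! hcon
    exact hne (Complex.ext (hcon Complex.reCLM) (hcon Complex.imCLM))
  obtain ⟨k, hk, hweak⟩ := hF.exists_weak T
  have hpos := edgeIntegral_mul_self_pos hk.continuousOn hx₀ hT
  -- Testing with the constant 1 gives μ ∫ f = 0. With mean zero, the Poincaré inequality reads ∫ f²
  -- ≤ κ μ ∫ f².
  have hmean : G.edgeIntegral (fun e t => T (F (G.pt e t))) = 0 := by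
    have := hweak _ _ _ (isH1_const 1)
    simp only [one_mul, zero_mul, edgeIntegral_const] at this
    exact (mul_eq_zero.1 this).resolve_left hμ0
  have h1 := hP _ _ _ hk
  rw [variance, hmean, ← hweak _ _ _ hk] at h1
  simp only [mul_zero, zero_div, sub_zero] at h1
  rw [inv_le_iff_one_le_mul₀ hκ]
  by_contra! hlt
  nlinarith

end MetricGraph

/-! ### The profile along a piecewise linear height -/

theorem integral_profileDeriv_comp {A B a b q : ℝ} (hq : 0 < q) {H S : ℝ → ℝ} {α x v σ : ℝ}
    (hx : α ≤ x) (hH : ∀ s, α < s → s ≤ x → H s = v + σ * (s - α))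
    (hS : ∀ s, α < s → s ≤ x → S s = σ) :
    ∫ s in α..x, profileDeriv A B a b q (H s) * S s =
      profile A B a b q (v + σ * (x - α)) - profile A B a b q v := by
  have e1 : ∫ s in α..x, profileDeriv A B a b q (H s) * S s =
      σ * ∫ s in α..x, profileDeriv A B a b q ((v - σ * α) + σ * s) := by
    rw [← intervalIntegral.integral_const_mul]
    refine intervalIntegral.integral_congr_ae (Filter.Eventually.of_forall fun s hs => ?_)
    rw [Set.uIoc_of_le hx] at hs
    rw [hH s hs.1 hs.2, hS s hs.1 hs.2, mul_comm]
    congr 2; ring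
  rw [e1, intervalIntegral.mul_integral_comp_add_mul, integral_profileDeriv hq]
  congr 2 <;> ring

/-- Substituting the level for the position yields σ times the increment of the primitive as the
integral with both terms weighted by σ². Replacing the weight of the first term by 1 only increases
it. -/
theorem le_integral_profile_comp {A B a b q : ℝ} (hq : 0 < q) (hab : a + q ≤ b) {H S : ℝ → ℝ}
    {α x v σ : ℝ} (hx : α ≤ x) (hσ : |σ| ≤ 1)
    (hH : ∀ s, α < s → s ≤ x → H s = v + σ * (s - α)) (hS : ∀ s, α < s → s ≤ x → S s = σ) :
    σ * (profilePrimitive A B a b q (v + σ * (x - α)) - profilePrimitive A B a b q v) ≤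
      ∫ s in α..x, ((Real.pi / (2 * q)) ^ 2 * profile A B a b q (H s) ^ 2 -
        (profileDeriv A B a b q (H s) * S s) ^ 2) := by
  set k := Real.pi / (2 * q) with hk
  have hσ2 : σ ^ 2 ≤ 1 := (sq_le_one_iff_abs_le_one σ).2 hσ
  have hm : Measurable fun s : ℝ => (v - σ * α) + σ * s := by fun_prop
  have hc : Continuous fun s : ℝ => profile A B a b q ((v - σ * α) + σ * s) ^ 2 := by
    have := continuous_profile A B a b q
    fun_prop
  have hiφ : IntervalIntegrable (fun s => k ^ 2 * profile A B a b q ((v - σ * α) + σ * s) ^ 2)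
      volume α x := (hc.intervalIntegrable _ _).const_mul _
  have hiψ := integrable_comp_profileDeriv_sq (A := A) (B := B) (a := a) (b := b) hq hm α x
  have e1 : σ * (profilePrimitive A B a b q (v + σ * (x - α)) - profilePrimitive A B a b q v) =
      ∫ s in α..x, σ ^ 2 * (k ^ 2 * profile A B a b q ((v - σ * α) + σ * s) ^ 2 -
        profileDeriv A B a b q ((v - σ * α) + σ * s) ^ 2) := by
    rw [intervalIntegral.integral_const_mul, sq σ, mul_assoc]
    congr 1
    rw [intervalIntegral.mul_integral_comp_add_mul
      (f := fun t => k ^ 2 * profile A B a b q t ^ 2 - profileDeriv A B a b q t ^ 2),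
      integral_profile_sq_sub hq hab]
    congr 2 <;> ring
  have e2 : ∫ s in α..x, (k ^ 2 * profile A B a b q (H s) ^ 2 -
        (profileDeriv A B a b q (H s) * S s) ^ 2) =
      ∫ s in α..x, (k ^ 2 * profile A B a b q ((v - σ * α) + σ * s) ^ 2 -
        σ ^ 2 * profileDeriv A B a b q ((v - σ * α) + σ * s) ^ 2) := by
    refine intervalIntegral.integral_congr_ae (Filter.Eventually.of_forall fun s hs => ?_)
    rw [Set.uIoc_of_le hx] at hs
    rw [hH s hs.1 hs.2, hS s hs.1 hs.2,
      show v + σ * (s - α) = (v - σ * α) + σ * s by ring]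
    ring
  rw [e1, e2]
  refine intervalIntegral.integral_mono_on hx ((hiφ.sub hiψ).const_mul _)
    (hiφ.sub (hiψ.const_mul _)) fun s _ => ?_
  have : 0 ≤ k ^ 2 * profile A B a b q ((v - σ * α) + σ * s) ^ 2 := by positivity
  nlinarith

open Classical in
/-- The net outflow at the level `p` of slopes `σ i` along pieces from the level `x i` to the level
`y i`. -/
noncomputable def outflow {ι : Type*} [Fintype ι] (x y σ : ι → ℝ) (p : ℝ) : ℝ :=
  ∑ i, σ i * ((if y i = p then 1 else 0) - if x i = p then 1 else 0)

/-- Summation by parts: the terms are regrouped by the levels at the ends of the pieces. Since the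
slope of a piece has the sign of its rise, its upper end counts with +|σ| and its lower end with
-|σ|, whatever its orientation. -/
theorem sum_mul_sub_eq_sum_outflow {ι : Type*} [Fintype ι] {x y σ : ι → ℝ} {J : Finset ℝ}
    (hx : ∀ i, x i ∈ J) (hy : ∀ i, y i ∈ J) (β : ℝ → ℝ) :
    ∑ i, σ i * (β (y i) - β (x i)) = ∑ p ∈ J, β p * outflow x y σ p := by
  classical
  simp only [outflow, Finset.mul_sum]
  rw [Finset.sum_comm]
  refine Finset.sum_congr rfl fun i _ => ?_
  have e : ∀ p, β p * (σ i * ((if y i = p then 1 else 0) - if x i = p then 1 else 0)) =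
      (if y i = p then σ i * β p else 0) - if x i = p then σ i * β p else 0 := fun p => by
    split_ifs <;> ring
  simp only [e]
  rw [Finset.sum_sub_distrib, Finset.sum_ite_eq, Finset.sum_ite_eq, if_pos (hy i), if_pos (hx i)]
  ring

theorem sin_two_windowPhase_nonneg {a q : ℝ} (hq : 0 < q) (t : ℝ) :
    0 ≤ Real.sin (2 * windowPhase a q t) :=
  Real.sin_nonneg_of_nonneg_of_le_pi (by linarith [windowPhase_nonneg (a := a) (t := t) hq])
    (by linarith [windowPhase_le (a := a) (t := t) hq])

theorem sin_two_windowPhase_eq_zero {a q t : ℝ} (hq : 0 < q) (h : ¬(a < t ∧ t < a + q)) :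
    Real.sin (2 * windowPhase a q t) = 0 := by
  rcases le_or_gt t a with h1 | h1
  · rw [windowPhase_of_le hq h1]; simp
  · rw [windowPhase_of_ge hq (not_lt.1 fun h2 => h ⟨h1, h2⟩), mul_div_cancel₀ _ two_ne_zero,
      Real.sin_pi]

/-- The terms with `min` and `max` are monotone and so are nonnegative piece by piece. The sine
terms vanish outside their windows, and inside them the sign conditions on the outflow apply after
summation by parts. -/
theorem sum_mul_profilePrimitive_nonneg {ι : Type*} [Fintype ι] {x y σ : ι → ℝ} {J : Finset ℝ}
    {A B a b q : ℝ} (hq : 0 < q) (hx : ∀ i, x i ∈ J) (hy : ∀ i, y i ∈ J)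
    (hσ : ∀ i, 0 ≤ σ i * (y i - x i))
    (ha : ∀ p ∈ J, a < p → p < a + q → 0 ≤ outflow x y σ p)
    (hb : ∀ p ∈ J, b < p → p < b + q → outflow x y σ p ≤ 0) :
    0 ≤ ∑ i, σ i * (profilePrimitive A B a b q (y i) - profilePrimitive A B a b q (x i)) := by
  set k := Real.pi / (2 * q) with hk
  have hk0 : 0 < k := by positivity
  have hmono : ∀ {M : ℝ → ℝ}, Monotone M → ∀ i, 0 ≤ σ i * (M (y i) - M (x i)) := fun {M} hM i => by
    have h := hσ i
    rcases lt_trichotomy (x i) (y i) with hlt | heq | hlt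
    · exact mul_nonneg (nonneg_of_mul_nonneg_left h (sub_pos.2 hlt)) (sub_nonneg.2 (hM hlt.le))
    · simp [heq]
    · refine mul_nonneg_of_nonpos_of_nonpos ?_ (sub_nonpos.2 (hM hlt.le))
      by_contra! hpos
      nlinarith
  have h1 := Finset.sum_nonneg fun i (_ : i ∈ Finset.univ) =>
    hmono (M := fun t => min t a) (fun s t h => min_le_min_right a h) i
  have h2 := Finset.sum_nonneg fun i (_ : i ∈ Finset.univ) =>
    hmono (M := fun t => max (t - (b + q)) 0)
      (fun s t h => max_le_max_right 0 (by simpa using h)) i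
  have h3 := sum_mul_sub_eq_sum_outflow (σ := σ) hx hy fun t => Real.sin (2 * windowPhase a q t)
  have h4 := sum_mul_sub_eq_sum_outflow (σ := σ) hx hy fun t => Real.sin (2 * windowPhase b q t)
  have h5 : 0 ≤ ∑ p ∈ J, Real.sin (2 * windowPhase a q p) * outflow x y σ p :=
    Finset.sum_nonneg fun p hp => by
      by_cases h : a < p ∧ p < a + q
      · exact mul_nonneg (sin_two_windowPhase_nonneg hq p) (ha p hp h.1 h.2)
      · rw [sin_two_windowPhase_eq_zero hq h, zero_mul]
  have h6 : ∑ p ∈ J, Real.sin (2 * windowPhase b q p) * outflow x y σ p ≤ 0 :=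
    Finset.sum_nonpos fun p hp => by
      by_cases h : b < p ∧ p < b + q
      · exact mul_nonpos_of_nonneg_of_nonpos (sin_two_windowPhase_nonneg hq p) (hb p hp h.1 h.2)
      · rw [sin_two_windowPhase_eq_zero hq h, zero_mul]
  rw [← h3] at h5
  rw [← h4] at h6
  have e : ∑ i, σ i * (profilePrimitive A B a b q (y i) - profilePrimitive A B a b q (x i)) =
      A ^ 2 * k ^ 2 * (∑ i, σ i * (min (y i) a - min (x i) a)) +
      A ^ 2 * (k / 2) *
        (∑ i, σ i * (Real.sin (2 * windowPhase a q (y i)) - Real.sin (2 * windowPhase a q (x i)))) +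
      B ^ 2 * k ^ 2 * (∑ i, σ i * (max (y i - (b + q)) 0 - max (x i - (b + q)) 0)) -
      B ^ 2 * (k / 2) * ∑ i, σ i *
        (Real.sin (2 * windowPhase b q (y i)) - Real.sin (2 * windowPhase b q (x i))) := by
    simp only [Finset.mul_sum, ← Finset.sum_add_distrib, ← Finset.sum_sub_distrib]
    refine Finset.sum_congr rfl fun i _ => ?_
    simp only [profilePrimitive, ← hk]
    ring
  rw [e]
  have h7 := mul_nonneg (show 0 ≤ A ^ 2 * k ^ 2 by positivity) h1
  have h8 := mul_nonneg (show 0 ≤ A ^ 2 * (k / 2) by positivity) h5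
  have h9 := mul_nonneg (show 0 ≤ B ^ 2 * k ^ 2 by positivity) h2
  have h10 := mul_nonpos_of_nonneg_of_nonpos (show 0 ≤ B ^ 2 * (k / 2) by positivity) h6
  linarith

/-- The slopes of the piecewise linear function with value `v i` at the break point `c i`. -/
noncomputable def pieceSlope (c v : ℕ → ℝ) (i : ℕ) : ℝ := (v (i + 1) - v i) / (c (i + 1) - c i)

/-- The piecewise linear function with three pieces and with value `v i` at the break point
`c i`. -/
noncomputable def piecewiseLinear (c v : ℕ → ℝ) (s : ℝ) : ℝ :=
  if s ≤ c 1 then v 0 + pieceSlope c v 0 * (s - c 0)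
  else if s ≤ c 2 then v 1 + pieceSlope c v 1 * (s - c 1)
  else v 2 + pieceSlope c v 2 * (s - c 2)

/-- The derivative of `piecewiseLinear`. -/
noncomputable def piecewiseSlope (c v : ℕ → ℝ) (s : ℝ) : ℝ :=
  if s ≤ c 1 then pieceSlope c v 0 else if s ≤ c 2 then pieceSlope c v 1 else pieceSlope c v 2

section piecewise

variable {c v : ℕ → ℝ}

theorem abs_pieceSlope_le {i : ℕ} (h : |v (i + 1) - v i| ≤ c (i + 1) - c i) :
    |pieceSlope c v i| ≤ 1 := by
  rw [pieceSlope, abs_div]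
  exact div_le_one_of_le₀ (h.trans (le_abs_self _)) (abs_nonneg _)

/-- A piece of length zero has slope 0 by the convention on division, and the hypothesis then makes
its end values equal. So break points may coincide. -/
theorem pieceSlope_mul {i : ℕ} (h : |v (i + 1) - v i| ≤ c (i + 1) - c i) :
    v i + pieceSlope c v i * (c (i + 1) - c i) = v (i + 1) := by
  rcases eq_or_ne (c (i + 1) - c i) 0 with h0 | h0
  · rw [h0] at h ⊢
    have := abs_nonpos_iff.1 h
    linarith
  · rw [pieceSlope, div_mul_cancel₀ _ h0]; ring

theorem pieceSlope_mul_nonneg {i : ℕ} (h : |v (i + 1) - v i| ≤ c (i + 1) - c i) :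
    0 ≤ pieceSlope c v i * (v (i + 1) - v i) := by
  rw [pieceSlope, div_mul_eq_mul_div]
  exact div_nonneg (mul_self_nonneg _) ((abs_nonneg _).trans h)

variable (hcv : ∀ i < 3, |v (i + 1) - v i| ≤ c (i + 1) - c i)
include hcv

theorem piecewiseLinear_apply {i : ℕ} (hi : i ≤ 3) : piecewiseLinear c v (c i) = v i := by
  have m : ∀ i < 3, c i ≤ c (i + 1) := fun i hi => by
    linarith [(abs_nonneg _).trans (hcv i hi)]
  have e := fun i hi => pieceSlope_mul (hcv i hi)
  have m0 := m 0 (by norm_num); have m1 := m 1 (by norm_num); have m2 := m 2 (by norm_num)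
  have e0 := e 0 (by norm_num); have e1 := e 1 (by norm_num); have e2 := e 2 (by norm_num)
  norm_num at m0 m1 m2 e0 e1 e2
  have d1 := hcv 1 (by norm_num)
  have d2 := hcv 2 (by norm_num)
  norm_num at d1 d2
  unfold piecewiseLinear
  interval_cases i
  · rw [if_pos m0]; ring
  · rw [if_pos le_rfl, e0]
  · split_ifs with h
    · have h12 : c 2 = c 1 := le_antisymm h m1
      rw [h12, sub_self, abs_nonpos_iff] at d1
      rw [h12, e0]; linarith
    · exact e1
    · exact absurd le_rfl ‹_›
  · split_ifs with h h'
    · have h12 : c 2 = c 1 := le_antisymm (m2.trans h) m1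
      have h23 : c 3 = c 1 := le_antisymm h (m1.trans m2)
      rw [h12, sub_self, abs_nonpos_iff] at d1
      rw [h12, h23, sub_self, abs_nonpos_iff] at d2
      rw [h23, e0]; linarith
    · have h23 : c 3 = c 2 := le_antisymm h' m2
      rw [h23, sub_self, abs_nonpos_iff] at d2
      rw [h23, e1]; linarith
    · exact e2

theorem piecewiseLinear_eq {i : ℕ} (hi : i < 3) {s : ℝ} (h : c i < s) (h' : s ≤ c (i + 1)) :
    piecewiseLinear c v s = v i + pieceSlope c v i * (s - c i) := by
  have m1 : c 1 ≤ c 2 := by linarith [(abs_nonneg _).trans (hcv 1 (by norm_num))]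
  unfold piecewiseLinear
  interval_cases i
  · rw [if_pos h']
  · rw [if_neg h.not_ge, if_pos h']
  · rw [if_neg (m1.trans_lt h).not_ge, if_neg h.not_ge]

theorem piecewiseSlope_eq {i : ℕ} (hi : i < 3) {s : ℝ} (h : c i < s) (h' : s ≤ c (i + 1)) :
    piecewiseSlope c v s = pieceSlope c v i := by
  have m1 : c 1 ≤ c 2 := by linarith [(abs_nonneg _).trans (hcv 1 (by norm_num))]
  unfold piecewiseSlope
  interval_cases i
  · rw [if_pos h']
  · rw [if_neg h.not_ge, if_pos h']
  · rw [if_neg (m1.trans_lt h).not_ge, if_neg h.not_ge]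

theorem abs_piecewiseSlope_le (s : ℝ) : |piecewiseSlope c v s| ≤ 1 := by
  unfold piecewiseSlope
  split_ifs
  exacts [abs_pieceSlope_le (hcv 0 (by norm_num)), abs_pieceSlope_le (hcv 1 (by norm_num)),
    abs_pieceSlope_le (hcv 2 (by norm_num))]

omit hcv in
theorem measurable_piecewiseLinear : Measurable (piecewiseLinear c v) := by
  unfold piecewiseLinear
  refine Measurable.ite measurableSet_Iic (by fun_prop)
    (Measurable.ite measurableSet_Iic (by fun_prop) (by fun_prop))

omit hcv in
theorem measurable_piecewiseSlope : Measurable (piecewiseSlope c v) := by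
  unfold piecewiseSlope
  exact Measurable.ite measurableSet_Iic measurable_const
    (Measurable.ite measurableSet_Iic measurable_const measurable_const)

variable {A B a b q : ℝ} (hq : 0 < q)
include hq

theorem memLp_profileDeriv_piecewise (l : ℝ) :
    MemLp (fun s => profileDeriv A B a b q (piecewiseLinear c v s) * piecewiseSlope c v s) 2
      (volume.restrict (Set.Icc 0 l)) := by
  refine MemLp.of_bound (((measurable_profileDeriv A B a b q).comp
    measurable_piecewiseLinear).mul measurable_piecewiseSlope).aestronglyMeasurable
    ((|A| + |B|) * (Real.pi / (2 * q))) (Filter.Eventually.of_forall fun s => ?_)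
  rw [Real.norm_eq_abs, abs_mul]
  have h1 := abs_profileDeriv_le A B a b hq (piecewiseLinear c v s)
  exact (mul_le_of_le_one_right (abs_nonneg _) (abs_piecewiseSlope_le hcv s)).trans h1

/-- The formula holds on each affine piece and is carried across the break points by additivity of
the integral. -/
theorem profile_piecewiseLinear (h0 : c 0 = 0) {s : ℝ} (hs : s ∈ Set.Icc 0 (c 3)) :
    profile A B a b q (piecewiseLinear c v s) = profile A B a b q (piecewiseLinear c v 0) +
      ∫ t in (0 : ℝ)..s,
        profileDeriv A B a b q (piecewiseLinear c v t) * piecewiseSlope c v t := by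
  have m : ∀ i < 3, c i ≤ c (i + 1) := fun i hi => by
    linarith [(abs_nonneg _).trans (hcv i hi)]
  have m0 := m 0 (by norm_num); have m1 := m 1 (by norm_num); have m2 := m 2 (by norm_num)
  norm_num at m0 m1 m2
  have hint : ∀ {x y : ℝ}, x ∈ Set.Icc 0 (c 3) → y ∈ Set.Icc 0 (c 3) → IntervalIntegrable
      (fun s => profileDeriv A B a b q (piecewiseLinear c v s) * piecewiseSlope c v s)
      volume x y := fun hx hy =>
    (memLp_profileDeriv_piecewise hcv hq (c 3)).intervalIntegrable_of_restrict_Icc hx hy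
  have step : ∀ i < 3, c i ∈ Set.Icc 0 (c 3) →
      profile A B a b q (piecewiseLinear c v (c i)) = profile A B a b q (piecewiseLinear c v 0) +
        ∫ t in (0 : ℝ)..c i,
          profileDeriv A B a b q (piecewiseLinear c v t) * piecewiseSlope c v t →
      ∀ x ∈ Set.Icc 0 (c 3), c i ≤ x → x ≤ c (i + 1) →
      profile A B a b q (piecewiseLinear c v x) = profile A B a b q (piecewiseLinear c v 0) +
        ∫ t in (0 : ℝ)..x,
          profileDeriv A B a b q (piecewiseLinear c v t) * piecewiseSlope c v t := by
    intro i hi hci ih x hx h1 h2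
    rcases h1.eq_or_lt with rfl | h1'
    · exact ih
    rw [← intervalIntegral.integral_add_adjacent_intervals (hint ⟨le_rfl, hx.1.trans hx.2⟩ hci)
      (hint hci hx), ← add_assoc, ← ih, integral_profileDeriv_comp hq h1
        (fun s hs hs' => piecewiseLinear_eq hcv hi hs (hs'.trans h2))
        (fun s hs hs' => piecewiseSlope_eq hcv hi hs (hs'.trans h2)),
      piecewiseLinear_eq hcv hi h1' h2, piecewiseLinear_apply hcv hi.le]
    ring
  have s0 := step 0 (by norm_num) ⟨h0.ge, by linarith⟩ (by rw [h0]; simp)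
  have s1 := step 1 (by norm_num) ⟨by linarith, by linarith⟩
    (s0 _ ⟨by linarith, by linarith⟩ (by linarith) (by norm_num))
  have s2 := step 2 (by norm_num) ⟨by linarith, by linarith⟩
    (s1 _ ⟨by linarith, by linarith⟩ (by linarith) (by norm_num))
  norm_num at s0 s1 s2
  rcases le_or_gt s (c 1) with h1 | h1
  · exact s0 s hs.1 hs.2 (by linarith [hs.1]) h1
  rcases le_or_gt s (c 2) with h2 | h2
  · exact s1 s hs.1 hs.2 h1.le h2
  · exact s2 s hs.1 hs.2 h2.le hs.2

theorem sum_le_integral_profile_piecewise (hab : a + q ≤ b) (h0 : c 0 = 0)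
    (hc : ContinuousOn (fun s => profile A B a b q (piecewiseLinear c v s)) (Set.Icc 0 (c 3))) :
    ∑ i : Fin 3, pieceSlope c v i *
        (profilePrimitive A B a b q (v (i + 1)) - profilePrimitive A B a b q (v i)) ≤
      ∫ s in (0 : ℝ)..c 3, ((Real.pi / (2 * q)) ^ 2 *
        profile A B a b q (piecewiseLinear c v s) ^ 2 -
        (profileDeriv A B a b q (piecewiseLinear c v s) * piecewiseSlope c v s) ^ 2) := by
  have m : ∀ i < 3, c i ≤ c (i + 1) := fun i hi => by
    linarith [(abs_nonneg _).trans (hcv i hi)]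
  have m0 := m 0 (by norm_num); have m1 := m 1 (by norm_num); have m2 := m 2 (by norm_num)
  norm_num at m0 m1 m2
  have hmem : ∀ i ≤ 3, c i ∈ Set.Icc 0 (c 3) := fun i hi => by
    interval_cases i <;> constructor <;> linarith
  have hint : IntegrableOn (fun s => (Real.pi / (2 * q)) ^ 2 *
        profile A B a b q (piecewiseLinear c v s) ^ 2 -
        (profileDeriv A B a b q (piecewiseLinear c v s) * piecewiseSlope c v s) ^ 2)
      (Set.Icc 0 (c 3)) :=
    ((hc.pow 2).const_mul _).integrableOn_Icc.sub
      (memLp_profileDeriv_piecewise hcv hq (c 3)).integrable_sq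
  rw [← h0, ← intervalIntegral.sum_integral_adjacent_intervals fun i hi =>
    (hint.mono_set (Set.uIcc_subset_Icc (hmem i hi.le) (hmem (i + 1) hi))).intervalIntegrable,
    Fin.sum_univ_eq_sum_range (fun i => pieceSlope c v i *
        (profilePrimitive A B a b q (v (i + 1)) - profilePrimitive A B a b q (v i)))]
  refine Finset.sum_le_sum fun i hi => ?_
  have hi := Finset.mem_range.1 hi
  have := le_integral_profile_comp (A := A) (B := B) hq hab (m i hi)
    (abs_pieceSlope_le (hcv i hi)) (fun s => piecewiseLinear_eq hcv hi)
    (fun s => piecewiseSlope_eq hcv hi)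
  rwa [pieceSlope_mul (hcv i hi)] at this

end piecewise

theorem profile_eq_add (A B a b q t : ℝ) :
    profile A B a b q t = A * profile 1 0 a b q t + B * profile 0 1 a b q t := by
  simp only [profile]; ring

/-- A bound that decreases in `d` passes to the supremum. -/
theorem le_sq_div_sSup {lam c : ℝ} (hlam : 0 < lam) (hc : 0 ≤ c) {S : Set ℝ}
    (hS : ∀ d ∈ S, 0 < d → lam ≤ (c / (2 * d)) ^ 2) {d₀ : ℝ} (hd₀ : d₀ ∈ S) (hd₀' : 0 < d₀) :
    lam ≤ (c / (2 * sSup S)) ^ 2 := by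
  have hs : 0 < √lam := Real.sqrt_pos.2 hlam
  -- As `lam` is positive, the bounds on it also bound S above, so `sSup S` is a genuine supremum
  -- and not the default value.
  have hM : ∀ d ∈ S, d ≤ c / (2 * √lam) := fun d hd => by
    rcases le_or_gt d 0 with h | h
    · exact h.trans (by positivity)
    · have h1 := (Real.sqrt_le_left (by positivity)).2 (hS d hd h)
      rw [le_div_iff₀ (by positivity)] at h1 ⊢
      linarith
  have h1 : sSup S ≤ c / (2 * √lam) := csSup_le ⟨d₀, hd₀⟩ hM
  have h2 : 0 < sSup S := hd₀'.trans_le (le_csSup ⟨_, hM⟩ hd₀)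
  refine (Real.sqrt_le_left (by positivity)).1 ?_
  rw [le_div_iff₀ (by positivity)] at h1 ⊢
  linarith

/-! ### The trial function on the graph -/

namespace MetricGraph

variable {V E : Type*} {G : MetricGraph V E}

section trial

variable [Fintype E]

theorem edgeIntegral_pos {f : E → ℝ → ℝ} (hf : ∀ e, ContinuousOn (f e) (Set.Icc 0 (G.len e)))
    (hf0 : ∀ e x, 0 ≤ f e x) {e₀ : E} {x₀ : ℝ} (hx₀ : x₀ ∈ Set.Icc 0 (G.len e₀))
    (h0 : 0 < f e₀ x₀) : 0 < G.edgeIntegral f :=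
  Finset.sum_pos' (fun e _ => intervalIntegral.integral_nonneg (G.len_pos e).le
    fun _ _ => hf0 _ _) ⟨e₀, Finset.mem_univ _,
      intervalIntegral.integral_pos (G.len_pos e₀) (hf e₀) (fun _ _ => hf0 _ _) ⟨x₀, hx₀, h0⟩⟩

/-- Given a function on the graph that is linear with slope at most one on each of three pieces of
every edge, and at most `n` values of it at the break points, among them `0` and `D`, there is an
`H¹` function with mean zero and Rayleigh quotient at most `(π n / (2 D))²`. -/
theorem exists_trial (c v : E → ℕ → ℝ)
    (hcv : ∀ e, ∀ i < 3, |v e (i + 1) - v e i| ≤ c e (i + 1) - c e i)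
    (hc0 : ∀ e, c e 0 = 0) (hc3 : ∀ e, c e 3 = G.len e) (φ : V → ℝ)
    (hsrc : ∀ e, v e 0 = φ (G.src e)) (htgt : ∀ e, v e 3 = φ (G.tgt e)) (J : Finset ℝ)
    (hJ : ∀ e, ∀ i ≤ 3, v e i ∈ J) {D : ℝ} (hD : 0 < D) {e₀ e₁ : E} {i₀ i₁ : ℕ} (hi₀ : i₀ ≤ 3)
    (hi₁ : i₁ ≤ 3) (h0 : v e₀ i₀ = 0) (h1 : v e₁ i₁ = D) {n : ℕ} (hn : J.card ≤ n) :
    ∃ b u w, G.IsH1 b u w ∧ G.edgeIntegral u = 0 ∧ 0 < G.edgeIntegral (fun e t => u e t * u e t) ∧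
      G.edgeIntegral (fun e t => w e t * w e t) ≤
        (Real.pi * n / (2 * D)) ^ 2 * G.edgeIntegral fun e t => u e t * u e t := by
  have h0J : (0 : ℝ) ∈ J := h0 ▸ hJ e₀ i₀ hi₀
  have h1J : D ∈ J := h1 ▸ hJ e₁ i₁ hi₁
  have hn0 : 0 < n := (Finset.card_pos.2 ⟨_, h0J⟩).trans_le hn
  have hn0' : (0 : ℝ) < n := by exact_mod_cast hn0
  -- With this width, π / (2q) = πn / (2D), and n windows exactly fill [0, D].
  set q := D / n with hqdef
  have hq : 0 < q := by positivity
  have hk : Real.pi / (2 * q) = Real.pi * n / (2 * D) := by rw [hqdef]; field_simp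
  set x : E × Fin 3 → ℝ := fun i => v i.1 i.2 with hx
  set y : E × Fin 3 → ℝ := fun i => v i.1 (i.2 + 1) with hy
  set σ : E × Fin 3 → ℝ := fun i => pieceSlope (c i.1) (v i.1) i.2 with hσ
  obtain ⟨a, b, ha0, hab, hbD, ha, hb⟩ := exists_two_windows J (outflow x y σ) hD h0J h1J hn
    (show D = n * q by rw [hqdef]; field_simp)
  set H : E → ℝ → ℝ := fun e => piecewiseLinear (c e) (v e) with hH
  have hmem : ∀ e, ∀ i ≤ 3, c e i ∈ Set.Icc 0 (G.len e) := fun e i hi => by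
    have m : ∀ i < 3, c e i ≤ c e (i + 1) := fun i hi => by
      linarith [(abs_nonneg _).trans (hcv e i hi)]
    have m0 := m 0 (by norm_num); have m1 := m 1 (by norm_num); have m2 := m 2 (by norm_num)
    norm_num at m0 m1 m2
    rw [← hc3, ← hc0 e]
    interval_cases i <;> constructor <;> linarith
  have hHc : ∀ e, ∀ i ≤ 3, H e (c e i) = v e i := fun e i hi => piecewiseLinear_apply (hcv e) hi
  have hH1 : ∀ A B, G.IsH1 (fun z => profile A B a b q (φ z)) (fun e s => profile A B a b q (H e s))
      (fun e s => profileDeriv A B a b q (H e s) * piecewiseSlope (c e) (v e) s) := fun A B => by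
    refine ⟨fun e => memLp_profileDeriv_piecewise (hcv e) hq _, fun e => ?_, fun e => ?_,
      fun e s hs => profile_piecewiseLinear (hcv e) hq (hc0 e) (by rwa [hc3])⟩
    · have := hHc e 0 (by norm_num)
      rw [hc0] at this
      simp only [this, hsrc]
    · have := hHc e 3 le_rfl
      rw [hc3] at this
      simp only [this, htgt]
  set M := G.edgeIntegral fun e s => profile 1 0 a b q (H e s) with hM
  set N := G.edgeIntegral fun e s => profile 0 1 a b q (H e s) with hN
  have hcos0 : ∀ t, 0 ≤ Real.cos (windowPhase a q t) := fun t =>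
    Real.cos_nonneg_of_neg_pi_div_two_le_of_le
      (by linarith [windowPhase_nonneg (a := a) (t := t) hq, Real.pi_pos]) (windowPhase_le hq)
  have hsin0 : ∀ t, 0 ≤ Real.sin (windowPhase b q t) := fun t =>
    Real.sin_nonneg_of_nonneg_of_le_pi (windowPhase_nonneg hq)
      (by linarith [windowPhase_le (a := b) (t := t) hq, Real.pi_pos])
  have hcos : 0 < Real.cos (windowPhase a q 0) := Real.cos_pos_of_mem_Ioo
    ⟨by linarith [windowPhase_nonneg (a := a) (t := 0) hq, Real.pi_pos],
      windowPhase_lt hq (by linarith)⟩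
  have hsin : 0 < Real.sin (windowPhase b q D) := Real.sin_pos_of_pos_of_lt_pi
    (windowPhase_pos hq (by linarith))
    (by linarith [windowPhase_le (a := b) (t := D) hq, Real.pi_pos])
  -- The cosine part is nonnegative, and positive at the level 0 since 0 < a + q. Likewise the sine
  -- part is positive at the level D since b < D.
  have hM0 : 0 < M := edgeIntegral_pos (hH1 1 0).continuousOn
    (fun e s => by simpa [profile] using hcos0 _) (hmem e₀ i₀ hi₀)
    (by rw [hHc e₀ i₀ hi₀, h0]; simpa [profile] using hcos)
  have hN0 : N < 0 := by
    have h2 : 0 < G.edgeIntegral fun e s => -1 * profile 0 1 a b q (H e s) :=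
      edgeIntegral_pos (fun e => continuousOn_const.mul ((hH1 0 1).continuousOn e))
        (fun e s => by simpa [profile] using hsin0 _) (hmem e₁ i₁ hi₁)
        (by rw [hHc e₁ i₁ hi₁, h1]; simpa [profile] using hsin)
    rw [edgeIntegral_const_mul] at h2
    linarith
  -- With A = -N and B = M the mean A M + B N vanishes.
  have hu := hH1 (-N) M
  refine ⟨_, _, _, hu, ?_, ?_, ?_⟩
  · simp only [profile_eq_add (-N) M]
    rw [edgeIntegral_add (fun e => ((hH1 1 0).intervalIntegrable e).const_mul _)
      (fun e => ((hH1 0 1).intervalIntegrable e).const_mul _), edgeIntegral_const_mul,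
      edgeIntegral_const_mul]
    simp only [← hM, ← hN]
    ring
  · refine edgeIntegral_mul_self_pos hu.continuousOn (hmem e₀ i₀ hi₀) ?_
    rw [hHc e₀ i₀ hi₀, h0, profile, windowPhase_of_le (a := b) hq (by linarith)]
    simp only [Real.sin_zero, mul_zero, sub_zero]
    exact (mul_pos (by linarith) hcos).ne'
  · have hsum := sum_mul_profilePrimitive_nonneg (A := -N) (B := M) hq
      (fun i : E × Fin 3 => hJ i.1 i.2 i.2.2.le) (fun i : E × Fin 3 => hJ i.1 (i.2 + 1) i.2.2)
      (fun i => pieceSlope_mul_nonneg (hcv i.1 i.2 i.2.2)) ha hb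
    rw [Fintype.sum_prod_type] at hsum
    have hle := hsum.trans (Finset.sum_le_sum fun e _ =>
      sum_le_integral_profile_piecewise (A := -N) (B := M) (hcv e) hq hab (hc0 e)
        (by rw [hc3]; exact hu.continuousOn e))
    have hsplit : ∑ e, ∫ s in (0 : ℝ)..c e 3, ((Real.pi / (2 * q)) ^ 2 *
        profile (-N) M a b q (piecewiseLinear (c e) (v e) s) ^ 2 -
        (profileDeriv (-N) M a b q (piecewiseLinear (c e) (v e) s) *
          piecewiseSlope (c e) (v e) s) ^ 2) =
        (Real.pi / (2 * q)) ^ 2 * G.edgeIntegral (fun e s => profile (-N) M a b q (H e s) *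
          profile (-N) M a b q (H e s)) - G.edgeIntegral (fun e s =>
          profileDeriv (-N) M a b q (H e s) * piecewiseSlope (c e) (v e) s *
          (profileDeriv (-N) M a b q (H e s) * piecewiseSlope (c e) (v e) s)) := by
      rw [← edgeIntegral_const_mul, edgeIntegral, edgeIntegral, ← Finset.sum_sub_distrib]
      refine Finset.sum_congr rfl fun e _ => ?_
      rw [hc3, ← intervalIntegral.integral_sub]
      · simp only [sq, hH]
      · exact ContinuousOn.intervalIntegrable_of_Icc (G.len_pos e).le
          (((hu.continuousOn e).mul (hu.continuousOn e)).const_mul _)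
      · have : IntegrableOn _ (Set.Icc 0 (G.len e)) := (hu.memLp e).integrable_mul (hu.memLp e)
        exact (this.mono_set (by rw [Set.uIcc_of_le (G.len_pos e).le])).intervalIntegrable
    rw [hsplit, hk] at hle
    linarith

end trial

/-! ### The distance function and marked points -/

section distance

theorem IsPathLength.nonneg {x y : G.Point} {r : ℝ} (h : G.IsPathLength x y r) : 0 ≤ r := by
  induction h with
  | refl => exact le_rfl
  | step e s t hs ht _ ih => exact add_nonneg ih (abs_nonneg _)

theorem pathDist_le {x y : G.Point} {r : ℝ} (h : G.IsPathLength x y r) : G.pathDist x y ≤ r :=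
  csInf_le ⟨0, fun _ h => h.nonneg⟩ h

theorem pathDist_nonneg (x y : G.Point) : 0 ≤ G.pathDist x y :=
  Real.sInf_nonneg fun _ h => IsPathLength.nonneg h

theorem pathDist_self (x : G.Point) : G.pathDist x x = 0 :=
  (pathDist_le (.refl x)).antisymm (pathDist_nonneg x x)

theorem IsConnected.pathDist_pt_le (hG : G.IsConnected) (x : G.Point) {e : E} {s t : ℝ}
    (hs : s ∈ Set.Icc 0 (G.len e)) (ht : t ∈ Set.Icc 0 (G.len e)) :
    G.pathDist x (G.pt e t) ≤ G.pathDist x (G.pt e s) + |t - s| := by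
  rw [← sub_le_iff_le_add]
  exact le_csInf (hG x _) fun r hr => sub_le_iff_le_add.2 (pathDist_le (.step e s t hs ht hr))

theorem IsConnected.abs_pathDist_pt_sub_le (hG : G.IsConnected) (x : G.Point) {e : E} {s t : ℝ}
    (hs : s ∈ Set.Icc 0 (G.len e)) (ht : t ∈ Set.Icc 0 (G.len e)) :
    |G.pathDist x (G.pt e t) - G.pathDist x (G.pt e s)| ≤ |t - s| := by
  have h1 := hG.pathDist_pt_le x hs ht
  have h2 := hG.pathDist_pt_le x ht hs
  rw [abs_sub_comm s t] at h2
  exact abs_sub_le_iff.2 ⟨by linarith, by linarith⟩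

/-- Distinct vertices have positive distance. -/
theorem IsConnected.pathDist_vertex_pos [Finite E] (hG : G.IsConnected) {u v : V} (huv : u ≠ v) :
    0 < G.pathDist (G.vertex u) (G.vertex v) := by
  classical
  obtain ⟨ε, hε, hle⟩ : ∃ ε > 0, ∀ e, ε ≤ G.len e := by
    rcases isEmpty_or_nonempty E with h | h
    · exact ⟨1, one_pos, fun e => h.elim e⟩
    · obtain ⟨e, he⟩ := Finite.exists_min G.len
      exact ⟨_, G.len_pos e, he⟩
  -- With ε at most every edge length, the edgewise affine function that is ε at v and 0 at the
  -- other vertices changes by at most the length of a path along it. Hence every path from u to v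
  -- has length at least ε.
  let a : V → ℝ := fun w => if w = v then ε else 0
  have ha : ∀ w w', |a w - a w'| ≤ ε := fun w w' => by
    simp only [a]; split_ifs <;> simp [abs_of_pos hε, hε.le]
  let k : G.Point → ℝ := Quot.lift (Sum.elim a fun p =>
      a (G.src p.1) + (a (G.tgt p.1) - a (G.src p.1)) / G.len p.1 * p.2) (by
    rintro _ _ (e | e)
    · simp
    · simp [(G.len_pos e).ne'])
  have hk : ∀ e, ∀ s ∈ Set.Icc 0 (G.len e),
      k (G.pt e s) = a (G.src e) + (a (G.tgt e) - a (G.src e)) / G.len e * s := fun e s hs => by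
    rw [pt, Set.projIcc_of_mem _ hs]; rfl
  have hpath : ∀ {x y r}, G.IsPathLength x y r → |k y - k x| ≤ r := by
    intro x y r h
    induction h with
    | refl => simp
    | @step r e s t hs ht _ ih =>
      have h1 : |k (G.pt e t) - k (G.pt e s)| ≤ |t - s| := by
        rw [hk e t ht, hk e s hs, add_sub_add_left_eq_sub, ← mul_sub, abs_mul, abs_div,
          abs_of_pos (G.len_pos e)]
        exact mul_le_of_le_one_left (abs_nonneg _)
          (div_le_one_of_le₀ ((ha _ _).trans (hle e)) (G.len_pos e).le)
      linarith [abs_sub_le (k (G.pt e t)) (k (G.pt e s)) (k x)]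
  refine hε.trans_le (le_csInf (hG _ _) fun r hr => ?_)
  have := hpath hr
  have h1 : k (G.vertex u) = 0 := if_neg huv
  have h2 : k (G.vertex v) = ε := if_pos rfl
  rwa [h1, h2, sub_zero, abs_of_pos hε] at this

/-- On a connected graph with two distinct vertices, every vertex is an end of some edge. -/
theorem IsConnected.exists_edge (hG : G.IsConnected) {u v : V} (huv : u ≠ v) :
    ∃ e, G.src e = u ∨ G.tgt e = u := by
  classical
  by_contra! h
  have := hG.eq_of_src_eq_tgt (a := fun w => if w = u then 1 else 0)
    (fun e => by simp [(h e).1, (h e).2]) u v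
  simp [huv.symm] at this

/-- The break points `0 ≤ min p r ≤ max p r ≤ l`. -/
noncomputable def breakPoints (l p r : ℝ) : ℕ → ℝ
  | 0 => 0
  | 1 => min p r
  | 2 => max p r
  | _ => l

theorem breakPoints_mem {l p r : ℝ} (hp : p ∈ Set.Icc 0 l) (hr : r ∈ Set.Icc 0 l) (i : ℕ) :
    breakPoints l p r i ∈ Set.Icc 0 l := by
  have hl : 0 ≤ l := hp.1.trans hp.2
  match i with
  | 0 => exact ⟨le_rfl, hl⟩
  | 1 => exact ⟨le_min hp.1 hr.1, (min_le_left _ _).trans hp.2⟩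
  | 2 => exact ⟨hp.1.trans (le_max_left _ _), max_le hp.2 hr.2⟩
  | _ + 3 => exact ⟨hl, le_rfl⟩

theorem breakPoints_le_succ {l p r : ℝ} (hp : p ∈ Set.Icc 0 l) (hr : r ∈ Set.Icc 0 l) (i : ℕ) :
    breakPoints l p r i ≤ breakPoints l p r (i + 1) :=
  match i with
  | 0 => le_min hp.1 hr.1
  | 1 => min_le_max
  | 2 => max_le hp.2 hr.2
  | _ + 3 => le_rfl

theorem breakPoints_eq (l p r : ℝ) (i : ℕ) : breakPoints l p r i = 0 ∨ breakPoints l p r i = p ∨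
    breakPoints l p r i = r ∨ breakPoints l p r i = l :=
  match i with
  | 0 => .inl rfl
  | 1 => (min_choice p r).elim (fun h => .inr (.inl h)) fun h => .inr (.inr (.inl h))
  | 2 => (max_choice p r).elim (fun h => .inr (.inl h)) fun h => .inr (.inr (.inl h))
  | _ + 3 => .inr (.inr (.inr rfl))

theorem exists_breakPoints_eq {l p r s : ℝ} (h : s = 0 ∨ s = p ∨ s = r ∨ s = l) :
    ∃ i ≤ 3, breakPoints l p r i = s := by
  rcases h with rfl | rfl | rfl | rfl
  · exact ⟨0, by norm_num, rfl⟩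
  · rcases le_total s r with h | h
    exacts [⟨1, by norm_num, min_eq_left h⟩, ⟨2, by norm_num, max_eq_left h⟩]
  · rcases le_total p s with h | h
    exacts [⟨2, by norm_num, max_eq_right h⟩, ⟨1, by norm_num, min_eq_right h⟩]
  · exact ⟨3, le_rfl, rfl⟩

/-- A trial function for two points at positive distance, given marked points `p e` and `r e` on
every edge `e` so that both points are marked points or vertices, where the marked points and the
vertices have at most `n` different distances to the first point. -/
theorem IsConnected.exists_trial_of_marks [Fintype E] (hG : G.IsConnected) {x y : G.Point}
    (hxy : 0 < G.pathDist x y) (p r : E → ℝ) (hp : ∀ e, p e ∈ Set.Icc 0 (G.len e))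
    (hr : ∀ e, r e ∈ Set.Icc 0 (G.len e)) (J : Finset ℝ)
    (hJ : ∀ v, G.pathDist x (G.vertex v) ∈ J) (hJp : ∀ e, G.pathDist x (G.pt e (p e)) ∈ J)
    (hJr : ∀ e, G.pathDist x (G.pt e (r e)) ∈ J) {n : ℕ} (hn : J.card ≤ n)
    (hx : ∃ e s, (s = 0 ∨ s = p e ∨ s = r e ∨ s = G.len e) ∧ G.pt e s = x)
    (hy : ∃ e s, (s = 0 ∨ s = p e ∨ s = r e ∨ s = G.len e) ∧ G.pt e s = y) :
    ∃ b u w, G.IsH1 b u w ∧ G.edgeIntegral u = 0 ∧ 0 < G.edgeIntegral (fun e t => u e t * u e t) ∧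
      G.edgeIntegral (fun e t => w e t * w e t) ≤
        (Real.pi * n / (2 * G.pathDist x y)) ^ 2 * G.edgeIntegral fun e t => u e t * u e t := by
  obtain ⟨e₀, s₀, hs₀, rfl⟩ := hx
  obtain ⟨e₁, s₁, hs₁, rfl⟩ := hy
  obtain ⟨i₀, hi₀, rfl⟩ := exists_breakPoints_eq hs₀
  obtain ⟨i₁, hi₁, rfl⟩ := exists_breakPoints_eq hs₁
  set x := G.pt e₀ (breakPoints (G.len e₀) (p e₀) (r e₀) i₀) with hx
  refine exists_trial (fun e => breakPoints (G.len e) (p e) (r e))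
    (fun e i => G.pathDist x (G.pt e (breakPoints (G.len e) (p e) (r e) i))) (fun e i _ => ?_)
    (fun _ => rfl) (fun _ => rfl) (fun v => G.pathDist x (G.vertex v)) (fun e => ?_) (fun e => ?_)
    J (fun e i _ => ?_) hxy hi₀ hi₁ (pathDist_self x) rfl hn
  · refine (hG.abs_pathDist_pt_sub_le x (breakPoints_mem (hp e) (hr e) i)
      (breakPoints_mem (hp e) (hr e) (i + 1))).trans_eq (abs_of_nonneg ?_)
    linarith [breakPoints_le_succ (hp e) (hr e) i]
  · rw [← pt_zero]; rfl
  · rw [← pt_len]; rfl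
  · rcases breakPoints_eq (G.len e) (p e) (r e) i with h | h | h | h
    · rw [h, pt_zero]; exact hJ _
    · rw [h]; exact hJp e
    · rw [h]; exact hJr e
    · rw [h, pt_len]; exact hJ _

/-- Both points are vertices, so marks at the coordinate 0 suffice and add no level: there are at
most as many levels as vertices. -/
theorem IsConnected.exists_trial_vertex [Fintype V] [Fintype E] (hG : G.IsConnected) {u v : V}
    (huv : 0 < G.pathDist (G.vertex u) (G.vertex v)) :
    ∃ b f g, G.IsH1 b f g ∧ G.edgeIntegral f = 0 ∧ 0 < G.edgeIntegral (fun e t => f e t * f e t) ∧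
      G.edgeIntegral (fun e t => g e t * g e t) ≤
        (Real.pi * (Fintype.card V : ℝ) / (2 * G.pathDist (G.vertex u) (G.vertex v))) ^ 2 *
          G.edgeIntegral fun e t => f e t * f e t := by
  classical
  have hne : u ≠ v := by
    rintro rfl
    rw [pathDist_self] at huv
    exact lt_irrefl _ huv
  have hend : ∀ {u v : V}, u ≠ v → ∃ e s, (s = 0 ∨ s = 0 ∨ s = 0 ∨ s = G.len e) ∧
      G.pt e s = G.vertex u := fun h => by
    obtain ⟨e, rfl | rfl⟩ := hG.exists_edge h
    exacts [⟨e, 0, by simp, pt_zero e⟩, ⟨e, G.len e, by simp, pt_len e⟩]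
  have hJ : ∀ w, G.pathDist (G.vertex u) (G.vertex w) ∈
      Finset.univ.image fun w => G.pathDist (G.vertex u) (G.vertex w) := fun w =>
    Finset.mem_image_of_mem _ (Finset.mem_univ w)
  exact hG.exists_trial_of_marks huv (fun _ => 0) (fun _ => 0) left_mem left_mem _ hJ
    (fun e => by rw [pt_zero]; exact hJ _) (fun e => by rw [pt_zero]; exact hJ _)
    Finset.card_image_le (hend hne) (hend hne.symm)

variable (G) in
theorem eq_vertex_or_eq_pt (x : G.Point) :
    (∃ w, x = G.vertex w) ∨ ∃ e, ∃ s ∈ Set.Icc 0 (G.len e), x = G.pt e s := by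
  induction x using Quot.ind with
  | mk z =>
    rcases z with w | ⟨e, s⟩
    · exact .inl ⟨w, rfl⟩
    · exact .inr ⟨e, s, s.2, by rw [pt, Set.projIcc_val]⟩

/-- Every point can be marked, with no other marked points than vertices. -/
theorem IsConnected.exists_marks (hG : G.IsConnected) {u v : V} (huv : u ≠ v) (x : G.Point) :
    ∃ p : E → ℝ, (∀ e, p e ∈ Set.Icc 0 (G.len e)) ∧
      (∀ e, G.pt e (p e) = x ∨ ∃ w, G.pt e (p e) = G.vertex w) ∧
      ∃ e s, (s = 0 ∨ s = p e ∨ s = G.len e) ∧ G.pt e s = x := by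
  classical
  rcases G.eq_vertex_or_eq_pt x with ⟨w, rfl⟩ | ⟨e₀, s₀, hs₀, rfl⟩
  · refine ⟨fun _ => 0, left_mem, fun e => .inr ⟨_, pt_zero e⟩, ?_⟩
    obtain ⟨w', hw'⟩ : ∃ w', w ≠ w' := by
      by_cases h : w = u
      exacts [⟨v, h ▸ huv⟩, ⟨u, h⟩]
    obtain ⟨e, rfl | rfl⟩ := hG.exists_edge hw'
    exacts [⟨e, 0, by simp, pt_zero e⟩, ⟨e, G.len e, by simp, pt_len e⟩]
  -- Only the edge that carries the point gets a genuine mark; elsewhere the mark sits at the source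
  -- vertex.
  · refine ⟨fun e => if e = e₀ then s₀ else 0, fun e => ?_, fun e => ?_, e₀, s₀, by simp, rfl⟩
    · by_cases h : e = e₀
      · subst h; simpa using hs₀
      · simp [h, (G.len_pos e).le]
    · by_cases h : e = e₀
      · subst h; simp
      · right; simp only [if_neg h]; exact ⟨_, pt_zero e⟩

/-- Marking x and y adds at most two levels, 0 and their distance, to those of the vertices. Two
marks per edge are allowed because x and y may lie on the same edge. -/
theorem IsConnected.exists_trial_point [Fintype V] [Fintype E] (hG : G.IsConnected) {u v : V}
    (huv : u ≠ v) {x y : G.Point} (hxy : 0 < G.pathDist x y) :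
    ∃ b f g, G.IsH1 b f g ∧ G.edgeIntegral f = 0 ∧ 0 < G.edgeIntegral (fun e t => f e t * f e t) ∧
      G.edgeIntegral (fun e t => g e t * g e t) ≤
        (Real.pi * ((Fintype.card V : ℝ) + 2) / (2 * G.pathDist x y)) ^ 2 *
          G.edgeIntegral fun e t => f e t * f e t := by
  classical
  obtain ⟨p, hp, hpx, hx⟩ := hG.exists_marks huv x
  obtain ⟨r, hr, hry, hy⟩ := hG.exists_marks huv y
  set J := Finset.univ.image (fun w => G.pathDist x (G.vertex w)) ∪
    {G.pathDist x x, G.pathDist x y} with hJdef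
  have hJ : ∀ w, G.pathDist x (G.vertex w) ∈ J := fun w =>
    Finset.mem_union_left _ (Finset.mem_image_of_mem _ (Finset.mem_univ w))
  have hn : J.card ≤ Fintype.card V + 2 :=
    (Finset.card_union_le _ _).trans (add_le_add Finset.card_image_le Finset.card_le_two)
  have := hG.exists_trial_of_marks hxy p r hp hr J hJ (fun e => ?_) (fun e => ?_) hn ?_ ?_
  · simpa only [Nat.cast_add, Nat.cast_ofNat] using this
  · rcases hpx e with h | ⟨w, h⟩
    · rw [h, hJdef]; simp
    · rw [h]; exact hJ w
  · rcases hry e with h | ⟨w, h⟩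
    · rw [h, hJdef]; simp
    · rw [h]; exact hJ w
  · obtain ⟨e, s, hs, h⟩ := hx
    exact ⟨e, s, by tauto, h⟩
  · obtain ⟨e, s, hs, h⟩ := hy
    exact ⟨e, s, by tauto, h⟩

end distance

end MetricGraph

/-! ### Conclusion -/

theorem theorem1 {V E : Type*} [Fintype V] [Fintype E] (G : MetricGraph V E)
    (hconn : G.IsConnected) (hV : 2 ≤ Fintype.card V) :
    ∃ lam : ℝ, G.IsSpectralGap lam ∧
      lam ≤ (Real.pi * ((Fintype.card V : ℝ) + 2) / (2 * G.diam)) ^ 2 ∧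
      lam ≤ (Real.pi * (Fintype.card V : ℝ) / (2 * G.vertexDiam)) ^ 2 := by
  obtain ⟨u, v, huv⟩ := Fintype.one_lt_card_iff.1 hV
  have hpos := hconn.pathDist_vertex_pos huv
  -- This trial function only supplies positive variance, which starts the direct method.
  obtain ⟨b, f, g, hf, hmean, hff, -⟩ := hconn.exists_trial_vertex hpos
  obtain ⟨lam, hlam, hgap, hP⟩ := hconn.exists_isSpectralGap hf
    (by simpa [MetricGraph.variance, hmean] using hff)
  have hbound : ∀ {c : ℝ}, (∃ b f g, G.IsH1 b f g ∧ G.edgeIntegral f = 0 ∧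
      0 < G.edgeIntegral (fun e t => f e t * f e t) ∧
      G.edgeIntegral (fun e t => g e t * g e t) ≤ c * G.edgeIntegral fun e t => f e t * f e t) →
      lam ≤ c := by
    rintro c ⟨b, f, g, hf, hmean, hff, hle⟩
    have := (hP b f g hf).trans hle
    rw [MetricGraph.variance, hmean, mul_zero, zero_div, sub_zero] at this
    exact le_of_mul_le_mul_right this hff
  refine ⟨lam, hgap, le_sq_div_sSup hlam (by positivity) ?_ ⟨_, _, rfl⟩ hpos,
    le_sq_div_sSup hlam (by positivity) ?_ ⟨_, _, rfl⟩ hpos⟩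
  · rintro _ ⟨x, y, rfl⟩ hxy
    exact hbound (hconn.exists_trial_point huv hxy)
  · rintro _ ⟨x, y, rfl⟩ hxy
    exact hbound (hconn.exists_trial_vertex hxy)
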